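/- Let $K$ be a field. A graded $K$-category is a $K$-linear category $\mathcal C$ with decompositions $\operatorname{Hom}_{\mathcal C}(X,Y)=\coprod_{i\in\mathbb Z}\operatorname{Hom}_{\mathcal C}(X,Y)_i$ such that degrees add under composition; it is positively graded if $\operatorname{Hom}_{\mathcal C}(X,Y)_i=0$ for all $X,Y$ and $i<0$. The opposite category $\mathcal C^{\mathrm{op}}$ is graded in the same way. $\operatorname{Gr}(\mathcal C)$ denotes the abelian category of $K$-linear graded functors $F\colon\mathcal C^{\mathrm{op}}\to\operatorname{Gr}(K)$ to $\mathbb Z$-graded $K$-vector spaces (a homogeneous morphism of degree $d$ is sent to a linear map of degree $d$) with the natural transformations of degree $0$ as morphisms; simple and projective objects and projective dimension refer to this category. $F$ is bounded below if there is an integer $N$ with $F(X)_i=0$ for all objects $X$ and all $i<N$. For $G\in\operatorname{Gr}(\mathcal C^{\mathrm{op}})$ and $F\in\operatorname{Gr}(\mathcal C)$, the graded vector space $G\otimes_{\mathcal C}F$ is the quotient of $\coprod_X G(X)\otimes_K F(X)$ by the relations $G(f)(g)\otimes x=g\otimes F(f)(x)$ for $f\colon X\to Y$, $g\in G(X)$,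 $x\in F(Y)$; $\operatorname{Tor}^{\mathcal C}_i(G,-)$ is the $i$-th left derived functor of $G\otimes_{\mathcal C}-$, and $F$ is flat if $-\otimes_{\mathcal C}F$ is exact. For an object $X$, the radical of the graded ring $\operatorname{End}_{\mathcal C}(X)$ is the intersection of its maximal graded left ideals, and $\operatorname{End}_{\mathcal C}(X)$ is graded local if it has exactly one maximal graded left ideal. The radical of $\mathcal C$ is $\operatorname{rad}_{\mathcal C}(X,Y)=\{f\colon X\to Y\mid gf\in\operatorname{rad}\operatorname{End}_{\mathcal C}(X)\text{ for all } g\colon Y\to X\}$. $\mathcal C$ is Krull-Schmidt if every object is a finite direct sum of objects with graded local endomorphism rings. **Proposition.** Let $\mathcal C$ be a skeletally small, additive (i.e. with finite direct sums), positively graded Krull-Schmidt $K$-category with $\operatorname{rad}_{\mathcal C}(X,Y)=\coprod_{i\ge 1}\operatorname{Hom}_{\mathcal C}(X,Y)_i$ for all objects $X,Y$. Let $F$ be a bounded below functor in $\operatorname{Gr}(\mathcal C)$. (a) If $S\otimes_{\mathcal C}F=0$ for all simple functors $S$ in $\operatorname{Gr}(\mathcal C^{\mathrm{op}})$, then $F=0$.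 (b) If $\operatorname{Tor}^{\mathcal C}_1(S,F)=0$ for all simple functors $S$ in $\operatorname{Gr}(\mathcal C^{\mathrm{op}})$, then $F$ is a projective object of $\operatorname{Gr}(\mathcal C)$. In particular, if $F$ is flat, then $F$ is projective. (c) Let $n\ge 0$. If every simple object of $\operatorname{Gr}(\mathcal C^{\mathrm{op}})$ has projective dimension at most $n$, then $F$ has projective dimension at most $n$. -/

import Mathlib

open CategoryTheory CategoryTheory.Limits
open scoped TensorProduct DirectSum

universe w k v u

/-! ### Graded `K`-categories -/

section OppositeLinear

variable {K : Type k} [Field K] {C : Type u} [Category.{v} C] [Preadditive C] [Linear K C]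

/-- The opposite of a `K`-linear category is `K`-linear. -/
instance oppositeLinear : Linear K Cᵒᵖ where
  homModule X Y := Equiv.module K (opEquiv X Y)
  smul_comp X Y Z r f g := by
    apply Quiver.Hom.unop_inj
    exact Linear.comp_smul (R := K) _ _ _ g.unop r f.unop
  comp_smul X Y Z f r g := by
    apply Quiver.Hom.unop_inj
    exact Linear.smul_comp (R := K) _ _ _ r g.unop f.unop

/-- Passing to the opposite, as a linear map on morphisms. -/
def unopLinear (X Y : Cᵒᵖ) : (X ⟶ Y) ≃ₗ[K] (Y.unop ⟶ X.unop) where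
  toEquiv := opEquiv X Y
  map_add' _ _ := rfl
  map_smul' _ _ := rfl

end OppositeLinear

/-- A grading on a `K`-linear category: every `Hom(X, Y)` is the internal direct sum of subspaces
`deg K X Y i`, `i ∈ ℤ`, in such a way that degrees add up under composition (and identities have
degree zero). -/
class GradedCategory (K : Type k) [Field K] (C : Type u) [Category.{v} C] [Preadditive C]
    [Linear K C] where
  /-- The homogeneous morphisms `X ⟶ Y` of degree `i`. -/
  deg : ∀ X Y : C, ℤ → Submodule K (X ⟶ Y)
  isInternal : ∀ X Y : C, DirectSum.IsInternal (deg X Y)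
  id_mem : ∀ X : C, 𝟙 X ∈ deg X X 0
  comp_mem : ∀ {X Y Z : C} {i j : ℤ} {f : X ⟶ Y} {g : Y ⟶ Z},
    f ∈ deg X Y i → g ∈ deg Y Z j → f ≫ g ∈ deg X Z (i + j)

section Graded

variable (K : Type k) [Field K] {C : Type u} [Category.{v} C] [Preadditive C] [Linear K C]
  [GradedCategory K C]

/-- The space of homogeneous morphisms of degree `i`. -/
abbrev homDeg (X Y : C) (i : ℤ) : Submodule K (X ⟶ Y) := GradedCategory.deg X Y i

variable {K} in
lemma homDeg_congr {X Y : C} {i j : ℤ} (h : i = j) {f : X ⟶ Y} (hf : f ∈ homDeg K X Y i) :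
    f ∈ homDeg K X Y j := h ▸ hf

variable {K} in
lemma homDeg_id (X : C) (i : ℤ) : 𝟙 X ∈ homDeg K X X (i - i) :=
  homDeg_congr (by omega) (GradedCategory.id_mem X)

variable {K} in
lemma homDeg_comp {X Y Z : C} {i j l : ℤ} {f : X ⟶ Y} {g : Y ⟶ Z}
    (hf : f ∈ homDeg K X Y (l - j)) (hg : g ∈ homDeg K Y Z (j - i)) :
    f ≫ g ∈ homDeg K X Z (l - i) :=
  homDeg_congr (by omega) (GradedCategory.comp_mem hf hg)

/-- The opposite of a graded category, with the same grading on morphisms. -/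
instance oppositeGraded : GradedCategory K Cᵒᵖ where
  deg X Y i := (homDeg K Y.unop X.unop i).comap (unopLinear (K := K) X Y).toLinearMap
  isInternal X Y := by
    have h := GradedCategory.isInternal (K := K) Y.unop X.unop
    rw [DirectSum.isInternal_submodule_iff_iSupIndep_and_iSup_eq_top] at h ⊢
    have e : ∀ i, (homDeg K Y.unop X.unop i).comap (unopLinear (K := K) X Y).toLinearMap =
        (Submodule.orderIsoMapComap (unopLinear (K := K) X Y)).symm (homDeg K Y.unop X.unop i) :=
      fun i ↦ rfl
    simp_rw [e]
    refine ⟨h.1.map_orderIso _, ?_⟩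
    rw [← OrderIso.map_iSup, h.2, OrderIso.map_top]
  id_mem X := GradedCategory.id_mem X.unop
  comp_mem {X Y Z i j f g} hf hg :=
    homDeg_congr (add_comm j i) (GradedCategory.comp_mem (K := K) (f := g.unop) (g := f.unop) hg hf)

variable {K} in
lemma homDeg_op {X Y : C} {i : ℤ} {f : X ⟶ Y} (hf : f ∈ homDeg K X Y i) :
    f.op ∈ homDeg K (Opposite.op Y) (Opposite.op X) i := hf

variable (C) in
/-- A graded category is positively graded if there are no nonzero morphisms of negative degree. -/
def IsPositivelyGraded : Prop := ∀ (X Y : C) (i : ℤ), i < 0 → homDeg K X Y i = ⊥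

/-- The morphisms whose homogeneous components all have degree at least one,
`∐_{i ≥ 1} Hom(X, Y)_i`. -/
def positivePart (X Y : C) : Submodule K (X ⟶ Y) := ⨆ (i : ℤ) (_ : 1 ≤ i), homDeg K X Y i

/-- A graded left ideal of the endomorphism ring: a left ideal generated by its homogeneous
elements. (In `End X` the product `a * b` is `a` after `b`.) -/
def IsGradedIdeal {X : C} (I : Ideal (End X)) : Prop :=
  I = Ideal.span {a : End X | a ∈ I ∧ ∃ i : ℤ, (a : X ⟶ X) ∈ homDeg K X X i}

/-- A maximal graded left ideal: maximal among the proper graded left ideals. -/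
def IsMaximalGradedIdeal {X : C} (I : Ideal (End X)) : Prop :=
  Maximal (fun J : Ideal (End X) ↦ IsGradedIdeal K J ∧ J ≠ ⊤) I

/-- The (graded Jacobson) radical of the graded ring `End X`: the intersection of its maximal
graded left ideals. -/
def gradedEndRadical (X : C) : Ideal (End X) := sInf {I | IsMaximalGradedIdeal K I}

/-- The radical of a graded category: the morphisms `f : X ⟶ Y` such that `g ∘ f` lies in the
radical of the graded ring `End X` for all `g : Y ⟶ X`. -/
def gradedRadical (X Y : C) : Set (X ⟶ Y) :=
  {f | ∀ g : Y ⟶ X, (f ≫ g : End X) ∈ gradedEndRadical K X}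

/-- The endomorphism ring of `X` is graded local: it has exactly one maximal graded left ideal. -/
def HasGradedLocalEnd (X : C) : Prop := ∃! I : Ideal (End X), IsMaximalGradedIdeal K I

variable (C) in
/-- A graded category is Krull-Schmidt if every object is a finite direct sum of objects with
graded local endomorphism rings. -/
def IsGradedKrullSchmidt [HasFiniteBiproducts C] : Prop :=
  ∀ X : C, ∃ (n : ℕ) (Z : Fin n → C), (∀ a, HasGradedLocalEnd K (Z a)) ∧ Nonempty (X ≅ ⨁ Z)

end Graded

/-! ### The abelian category of graded functors -/

/-- A (contravariant, `K`-linear) graded functor from a graded category `C` to graded `K`-vector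
spaces. The graded vector space `F(X) = ∐_i F(X)_i` is given by its components `obj X i`, and for
`f : X ⟶ Y` homogeneous of degree `j - i` the component `F(Y)_i → F(X)_j` of
`F(f) : F(Y) → F(X)` is `map f i j _`. -/
structure GrFunctor (K : Type k) [Field K] (C : Type u) [Category.{v} C] [Preadditive C]
    [Linear K C] [GradedCategory K C] where
  obj : C → ℤ → ModuleCat.{w} K
  map : ∀ {X Y : C} (f : X ⟶ Y) (i j : ℤ), f ∈ homDeg K X Y (j - i) → (obj Y i →ₗ[K] obj X j)
  map_add : ∀ {X Y : C} (f g : X ⟶ Y) (i j : ℤ) (hf : f ∈ homDeg K X Y (j - i))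
    (hg : g ∈ homDeg K X Y (j - i)),
    map (f + g) i j (add_mem hf hg) = map f i j hf + map g i j hg
  map_smul : ∀ {X Y : C} (c : K) (f : X ⟶ Y) (i j : ℤ) (hf : f ∈ homDeg K X Y (j - i)),
    map (c • f) i j (Submodule.smul_mem _ c hf) = c • map f i j hf
  map_id : ∀ (X : C) (i : ℤ), map (𝟙 X) i i (homDeg_id X i) = LinearMap.id
  map_comp : ∀ {X Y Z : C} (f : X ⟶ Y) (g : Y ⟶ Z) (i j l : ℤ)
    (hf : f ∈ homDeg K X Y (l - j)) (hg : g ∈ homDeg K Y Z (j - i)),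
    map (f ≫ g) i l (homDeg_comp hf hg) = map f j l hf ∘ₗ map g i j hg

namespace GrFunctor

variable {K : Type k} [Field K] {C : Type u} [Category.{v} C] [Preadditive C] [Linear K C]
  [GradedCategory K C]

/-- Morphisms of graded functors: natural transformations of degree zero. -/
@[ext]
structure Hom (F G : GrFunctor.{w} K C) where
  app : ∀ (X : C) (i : ℤ), F.obj X i →ₗ[K] G.obj X i
  naturality : ∀ {X Y : C} (f : X ⟶ Y) (i j : ℤ) (hf : f ∈ homDeg K X Y (j - i))
    (x : F.obj Y i), app X j (F.map f i j hf x) = G.map f i j hf (app Y i x)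

/-- The category of graded functors and natural transformations of degree zero. -/
instance : Category (GrFunctor.{w} K C) where
  Hom := Hom
  id F := { app := fun _ _ ↦ LinearMap.id, naturality := fun _ _ _ _ _ ↦ rfl }
  comp α β :=
    { app := fun X i ↦ β.app X i ∘ₗ α.app X i
      naturality := fun f i j hf x ↦ by simp [α.naturality, β.naturality] }

@[ext]
lemma hom_ext {F G : GrFunctor.{w} K C} {α β : F ⟶ G}
    (h : ∀ X i x, α.app X i x = β.app X i x) : α = β :=
  Hom.ext (funext fun X ↦ funext fun i ↦ LinearMap.ext (h X i))

@[simp] lemma id_app (F : GrFunctor.{w} K C) (X : C) (i : ℤ) (x : F.obj X i) :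
    Hom.app (𝟙 F) X i x = x := rfl

@[simp] lemma comp_app {F G H : GrFunctor.{w} K C} (α : F ⟶ G) (β : G ⟶ H) (X : C) (i : ℤ)
    (x : F.obj X i) : (α ≫ β).app X i x = β.app X i (α.app X i x) := rfl

instance {F G : GrFunctor.{w} K C} : Zero (F ⟶ G) :=
  ⟨{ app := fun _ _ ↦ 0, naturality := by simp }⟩

instance {F G : GrFunctor.{w} K C} : Add (F ⟶ G) :=
  ⟨fun α β ↦ { app := fun X i ↦ α.app X i + β.app X i
               naturality := by simp [α.naturality, β.naturality] }⟩

instance {F G : GrFunctor.{w} K C} : Neg (F ⟶ G) :=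
  ⟨fun α ↦ { app := fun X i ↦ -α.app X i, naturality := by simp [α.naturality] }⟩

@[simp] lemma zero_app {F G : GrFunctor.{w} K C} (X : C) (i : ℤ) (x : F.obj X i) :
    Hom.app (0 : F ⟶ G) X i x = 0 := rfl

@[simp] lemma add_app {F G : GrFunctor.{w} K C} (α β : F ⟶ G) (X : C) (i : ℤ) (x : F.obj X i) :
    (α + β).app X i x = α.app X i x + β.app X i x := rfl

@[simp] lemma neg_app {F G : GrFunctor.{w} K C} (α : F ⟶ G) (X : C) (i : ℤ) (x : F.obj X i) :
    (-α).app X i x = -α.app X i x := rfl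

instance {F G : GrFunctor.{w} K C} : AddCommGroup (F ⟶ G) where
  add_assoc _ _ _ := by ext; simp [add_assoc]
  zero_add _ := by ext; simp
  add_zero _ := by ext; simp
  add_comm _ _ := by ext; simp [add_comm]
  neg_add_cancel _ := by ext; simp
  nsmul := nsmulRec
  zsmul := zsmulRec

instance : Preadditive (GrFunctor.{w} K C) where
  add_comp _ _ _ _ _ _ := by ext; simp
  comp_add _ _ _ _ _ _ := by ext; simp

lemma map_congr (F : GrFunctor.{w} K C) {X Y : C} {f g : X ⟶ Y} (h : f = g) {i j : ℤ}
    (hf : f ∈ homDeg K X Y (j - i)) (hg : g ∈ homDeg K X Y (j - i)) :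
    F.map f i j hf = F.map g i j hg := by subst h; rfl

/-- The zero functor. -/
def zeroFunctor : GrFunctor.{w} K C where
  obj _ _ := ModuleCat.of K PUnit
  map _ _ _ _ := 0
  map_add _ _ _ _ _ _ := by ext
  map_smul _ _ _ _ _ := by ext
  map_id _ _ := by ext
  map_comp _ _ _ _ _ _ _ := by ext

instance : HasZeroObject (GrFunctor.{w} K C) where
  zero := ⟨zeroFunctor, by
    rw [IsZero.iff_id_eq_zero]
    ext X i x
    rfl⟩

/-- The direct sum of two graded functors. -/
def prodFunctor (F G : GrFunctor.{w} K C) : GrFunctor.{w} K C where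
  obj X i := ModuleCat.of K (F.obj X i × G.obj X i)
  map f i j hf := (F.map f i j hf).prodMap (G.map f i j hf)
  map_add f g i j hf hg := by rw [F.map_add _ _ _ _ hf hg, G.map_add _ _ _ _ hf hg]; rfl
  map_smul c f i j hf := by rw [F.map_smul _ _ _ _ hf, G.map_smul _ _ _ _ hf]; rfl
  map_id X i := by rw [F.map_id, G.map_id]; rfl
  map_comp f g i j l hf hg := by
    rw [F.map_comp _ _ _ _ _ hf hg, G.map_comp _ _ _ _ _ hf hg]; rfl

instance : HasBinaryBiproducts (GrFunctor.{w} K C) where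
  has_binary_biproduct F G := hasBinaryBiproduct_of_total
    { pt := prodFunctor F G
      fst := { app := fun X i ↦ LinearMap.fst K (F.obj X i) (G.obj X i)
               naturality := fun _ _ _ _ _ ↦ rfl }
      snd := { app := fun X i ↦ LinearMap.snd K (F.obj X i) (G.obj X i)
               naturality := fun _ _ _ _ _ ↦ rfl }
      inl := { app := fun X i ↦ LinearMap.inl K (F.obj X i) (G.obj X i)
               naturality := fun f i j hf x ↦
                Prod.ext rfl (_root_.map_zero (G.map f i j hf)).symm }
      inr := { app := fun X i ↦ LinearMap.inr K (F.obj X i) (G.obj X i)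
               naturality := fun f i j hf x ↦
                Prod.ext (_root_.map_zero (F.map f i j hf)).symm rfl }
      inl_fst := rfl
      inl_snd := rfl
      inr_fst := rfl
      inr_snd := rfl }
    (by
      ext X i x
      exact Prod.ext (add_zero x.1) (zero_add x.2))

instance : HasFiniteProducts (GrFunctor.{w} K C) :=
  haveI : HasTerminal (GrFunctor.{w} K C) := HasZeroObject.hasTerminal
  hasFiniteProducts_of_has_binary_and_terminal

/-- The kernel of a morphism of graded functors, computed componentwise. -/
def kernelFunctor {F G : GrFunctor.{w} K C} (α : F ⟶ G) : GrFunctor.{w} K C where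
  obj X i := ModuleCat.of K (LinearMap.ker (α.app X i))
  map {X Y} f i j hf := (F.map f i j hf).restrict
    (fun x hx ↦ by rw [LinearMap.mem_ker] at hx ⊢; rw [α.naturality, hx, _root_.map_zero])
  map_add f g i j hf hg := by
    exact LinearMap.ext fun x ↦ Subtype.ext (LinearMap.congr_fun (F.map_add _ _ _ _ hf hg) x.1)
  map_smul c f i j hf := by
    exact LinearMap.ext fun x ↦ Subtype.ext (LinearMap.congr_fun (F.map_smul _ _ _ _ hf) x.1)
  map_id X i := by exact LinearMap.ext fun x ↦ Subtype.ext (LinearMap.congr_fun (F.map_id X i) x.1)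
  map_comp f g i j l hf hg := by
    exact LinearMap.ext fun x ↦ Subtype.ext (LinearMap.congr_fun (F.map_comp _ _ _ _ _ hf hg) x.1)

/-- The inclusion of the kernel. -/
def kernelι {F G : GrFunctor.{w} K C} (α : F ⟶ G) : kernelFunctor α ⟶ F where
  app X i := (LinearMap.ker (α.app X i)).subtype
  naturality _ _ _ _ _ := rfl

lemma kernelι_comp {F G : GrFunctor.{w} K C} (α : F ⟶ G) : kernelι α ≫ α = 0 := by
  ext X i x
  exact x.2

/-- The factorisation of a morphism through the kernel. -/
def kernelLift {F G H : GrFunctor.{w} K C} (α : F ⟶ G) (β : H ⟶ F) (h : β ≫ α = 0) :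
    H ⟶ kernelFunctor α where
  app X i := (β.app X i).codRestrict _ (fun x ↦ by
    rw [LinearMap.mem_ker, ← comp_app, h, zero_app])
  naturality f i j hf x := Subtype.ext (β.naturality f i j hf x)

/-- The componentwise kernel is a kernel. -/
def kernelIsLimit {F G : GrFunctor.{w} K C} (α : F ⟶ G) :
    IsLimit (KernelFork.ofι (kernelι α) (kernelι_comp α)) :=
  KernelFork.IsLimit.ofι _ _ (fun β h ↦ kernelLift α β h) (fun _ _ ↦ rfl)
    (fun β h γ hγ ↦ by
      ext X i x
      exact Subtype.ext (congrArg (fun δ : _ ⟶ F ↦ δ.app X i x) hγ))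

instance : HasKernels (GrFunctor.{w} K C) where
  has_limit α := ⟨⟨_, kernelIsLimit α⟩⟩

/-- The cokernel of a morphism of graded functors, computed componentwise. -/
def cokernelFunctor {F G : GrFunctor.{w} K C} (α : F ⟶ G) : GrFunctor.{w} K C where
  obj X i := ModuleCat.of K (G.obj X i ⧸ LinearMap.range (α.app X i))
  map {X Y} f i j hf := Submodule.mapQ _ _ (G.map f i j hf) (by
    rintro _ ⟨x, rfl⟩
    exact ⟨F.map f i j hf x, α.naturality f i j hf x⟩)
  map_add f g i j hf hg := by
    apply Submodule.linearMap_qext; ext x; simp [G.map_add _ _ _ _ hf hg]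
  map_smul c f i j hf := by
    apply Submodule.linearMap_qext; ext x; simp [G.map_smul _ _ _ _ hf]
  map_id X i := by
    apply Submodule.linearMap_qext; ext x; simp [G.map_id]
  map_comp f g i j l hf hg := by
    apply Submodule.linearMap_qext; ext x; simp [G.map_comp _ _ _ _ _ hf hg]

/-- The projection onto the cokernel. -/
def cokernelπ {F G : GrFunctor.{w} K C} (α : F ⟶ G) : G ⟶ cokernelFunctor α where
  app X i := (LinearMap.range (α.app X i)).mkQ
  naturality _ _ _ _ _ := rfl

lemma comp_cokernelπ {F G : GrFunctor.{w} K C} (α : F ⟶ G) : α ≫ cokernelπ α = 0 := by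
  ext X i x
  exact (Submodule.Quotient.mk_eq_zero _).2 ⟨x, rfl⟩

/-- The factorisation of a morphism through the cokernel. -/
def cokernelDesc {F G H : GrFunctor.{w} K C} (α : F ⟶ G) (β : G ⟶ H) (h : α ≫ β = 0) :
    cokernelFunctor α ⟶ H where
  app X i := (LinearMap.range (α.app X i)).liftQ (β.app X i) (by
    rintro _ ⟨x, rfl⟩
    rw [LinearMap.mem_ker, ← comp_app, h, zero_app])
  naturality f i j hf x := by
    obtain ⟨x, rfl⟩ := Submodule.mkQ_surjective _ x
    exact β.naturality f i j hf x

/-- The componentwise cokernel is a cokernel. -/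
def cokernelIsColimit {F G : GrFunctor.{w} K C} (α : F ⟶ G) :
    IsColimit (CokernelCofork.ofπ (cokernelπ α) (comp_cokernelπ α)) :=
  CokernelCofork.IsColimit.ofπ _ _ (fun β h ↦ cokernelDesc α β h) (fun _ _ ↦ rfl)
    (fun β h γ hγ ↦ by
      ext X i x
      obtain ⟨x, rfl⟩ := Submodule.mkQ_surjective _ x
      exact congrArg (fun δ : G ⟶ _ ↦ δ.app X i x) hγ)

instance : HasCokernels (GrFunctor.{w} K C) where
  has_colimit α := ⟨⟨_, cokernelIsColimit α⟩⟩

lemma injective_of_mono {F G : GrFunctor.{w} K C} (α : F ⟶ G) [Mono α] (X : C) (i : ℤ) :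
    Function.Injective (α.app X i) := by
  have h : kernelι α = 0 := by
    rw [← cancel_mono α, kernelι_comp, zero_comp]
  rw [← LinearMap.ker_eq_bot, Submodule.eq_bot_iff]
  intro x hx
  exact congrArg (fun δ : kernelFunctor α ⟶ F ↦ δ.app X i ⟨x, hx⟩) h

lemma surjective_of_epi {F G : GrFunctor.{w} K C} (α : F ⟶ G) [Epi α] (X : C) (i : ℤ) :
    Function.Surjective (α.app X i) := by
  have h : cokernelπ α = 0 := by
    rw [← cancel_epi α, comp_cokernelπ, comp_zero]
  intro y
  exact (Submodule.Quotient.mk_eq_zero _).1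
    (congrArg (fun δ : G ⟶ cokernelFunctor α ↦ δ.app X i y) h)

lemma epi_of_surjective {F G : GrFunctor.{w} K C} (α : F ⟶ G)
    (h : ∀ X i, Function.Surjective (α.app X i)) : Epi α where
  left_cancellation β γ e := by
    ext X i y
    obtain ⟨x, rfl⟩ := h X i y
    exact congrArg (fun δ : F ⟶ _ ↦ δ.app X i x) e

/-- The factorisation, through a monomorphism, of a morphism killed by its cokernel. -/
noncomputable def monoLift {F G H : GrFunctor.{w} K C} (α : F ⟶ G) [Mono α] (β : H ⟶ G)
    (h : β ≫ cokernelπ α = 0) : H ⟶ F where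
  app X i := (LinearEquiv.ofInjective (α.app X i) (injective_of_mono α X i)).symm.toLinearMap ∘ₗ
    (β.app X i).codRestrict _ (fun x ↦ (Submodule.Quotient.mk_eq_zero _).1
      (congrArg (fun δ : H ⟶ cokernelFunctor α ↦ δ.app X i x) h))
  naturality {X Y} f i j hf x := by
    apply injective_of_mono α
    rw [α.naturality]
    simp only [LinearMap.comp_apply, LinearEquiv.coe_coe]
    erw [LinearEquiv.ofInjective_symm_apply, LinearEquiv.ofInjective_symm_apply]
    exact β.naturality f i j hf x

lemma monoLift_comp {F G H : GrFunctor.{w} K C} (α : F ⟶ G) [Mono α] (β : H ⟶ G)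
    (h : β ≫ cokernelπ α = 0) : monoLift α β h ≫ α = β := by
  ext X i x
  simp only [comp_app, monoLift, LinearMap.comp_apply, LinearEquiv.coe_coe]
  erw [LinearEquiv.ofInjective_symm_apply]
  rfl

/-- The factorisation, through an epimorphism, of a morphism that kills its kernel. -/
noncomputable def epiDesc {F G H : GrFunctor.{w} K C} (α : F ⟶ G) [Epi α] (β : F ⟶ H)
    (h : kernelι α ≫ β = 0) : G ⟶ H where
  app X i := (LinearMap.ker (α.app X i)).liftQ (β.app X i)
      (fun x hx ↦ congrArg (fun δ : kernelFunctor α ⟶ H ↦ δ.app X i ⟨x, hx⟩) h) ∘ₗ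
    ((α.app X i).quotKerEquivOfSurjective (surjective_of_epi α X i)).symm.toLinearMap
  naturality {X Y} f i j hf y := by
    obtain ⟨x, rfl⟩ := surjective_of_epi α Y i y
    rw [← α.naturality]
    simp only [LinearMap.comp_apply, LinearEquiv.coe_coe]
    erw [LinearMap.quotKerEquivOfSurjective_symm_apply,
      LinearMap.quotKerEquivOfSurjective_symm_apply]
    exact β.naturality f i j hf x

lemma comp_epiDesc {F G H : GrFunctor.{w} K C} (α : F ⟶ G) [Epi α] (β : F ⟶ H)
    (h : kernelι α ≫ β = 0) : α ≫ epiDesc α β h = β := by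
  ext X i x
  simp only [comp_app, epiDesc, LinearMap.comp_apply, LinearEquiv.coe_coe]
  erw [LinearMap.quotKerEquivOfSurjective_symm_apply]
  rfl

/-- The category of graded functors is abelian. -/
instance : Abelian (GrFunctor.{w} K C) where
  normalMonoOfMono α _ := ⟨
    { Z := cokernelFunctor α
      g := cokernelπ α
      w := comp_cokernelπ α
      isLimit := KernelFork.IsLimit.ofι _ _ (fun β h ↦ monoLift α β h)
        (fun β h ↦ monoLift_comp α β h)
        (fun β h γ hγ ↦ by rw [← cancel_mono α, hγ, monoLift_comp]) }⟩
  normalEpiOfEpi α _ := ⟨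
    { W := kernelFunctor α
      g := kernelι α
      w := kernelι_comp α
      isColimit := CokernelCofork.IsColimit.ofπ _ _ (fun β h ↦ epiDesc α β h)
        (fun β h ↦ comp_epiDesc α β h)
        (fun β h γ hγ ↦ by rw [← cancel_epi α, hγ, comp_epiDesc]) }⟩

/-! #### Projective graded functors -/

/-- Direct sums of graded functors. -/
noncomputable def sumFunctor {ι : Type w} (F : ι → GrFunctor.{w} K C) : GrFunctor.{w} K C where
  obj X i := ModuleCat.of K (⨁ a, (F a).obj X i)
  map f i j hf := DirectSum.lmap fun a ↦ (F a).map f i j hf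
  map_add f g i j hf hg := by
    refine LinearMap.ext fun x ↦ DFinsupp.ext fun a ↦ ?_
    exact LinearMap.congr_fun ((F a).map_add f g i j hf hg) (x a)
  map_smul c f i j hf := by
    refine LinearMap.ext fun x ↦ DFinsupp.ext fun a ↦ ?_
    exact LinearMap.congr_fun ((F a).map_smul c f i j hf) (x a)
  map_id X i := by
    refine LinearMap.ext fun x ↦ DFinsupp.ext fun a ↦ ?_
    exact LinearMap.congr_fun ((F a).map_id X i) (x a)
  map_comp f g i j l hf hg := by
    refine LinearMap.ext fun x ↦ DFinsupp.ext fun a ↦ ?_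
    exact LinearMap.congr_fun ((F a).map_comp f g i j l hf hg) (x a)

open Classical in
/-- The morphism out of a direct sum given by a family of morphisms. -/
noncomputable def sumDesc {ι : Type w} {F : ι → GrFunctor.{w} K C} {G : GrFunctor.{w} K C}
    (β : ∀ a, F a ⟶ G) : sumFunctor F ⟶ G where
  app X i := DirectSum.toModule K ι _ fun a ↦ (β a).app X i
  naturality {X Y} f i j hf x := by
    have : DirectSum.toModule K ι _ (fun a ↦ (β a).app X j) ∘ₗ
        (DirectSum.lmap fun a ↦ (F a).map f i j hf) =
        G.map f i j hf ∘ₗ DirectSum.toModule K ι _ (fun a ↦ (β a).app Y i) := by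
      refine DirectSum.linearMap_ext _ fun a ↦ LinearMap.ext fun x ↦ ?_
      simp [(β a).naturality]
    exact LinearMap.congr_fun this x

open Classical in
/-- The inclusion of a summand of a direct sum. -/
noncomputable def sumι {ι : Type w} (F : ι → GrFunctor.{w} K C) (a : ι) : F a ⟶ sumFunctor F where
  app X i := DirectSum.lof K ι (fun a ↦ (F a).obj X i) a
  naturality f i j hf x :=
    (DirectSum.lmap_lof (R := K) (fun a ↦ (F a).map f i j hf) a x).symm

open Classical in
@[simp] lemma sumι_desc {ι : Type w} {F : ι → GrFunctor.{w} K C} {G : GrFunctor.{w} K C}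
    (β : ∀ a, F a ⟶ G) (a : ι) : sumι F a ≫ sumDesc β = β a := by
  ext X i x
  exact DirectSum.toModule_lof K (φ := fun a ↦ (β a).app X i) a x

open Classical in
lemma sum_hom_ext {ι : Type w} {F : ι → GrFunctor.{w} K C} {G : GrFunctor.{w} K C}
    {β γ : sumFunctor F ⟶ G} (h : ∀ a, sumι F a ≫ β = sumι F a ≫ γ) : β = γ := by
  refine Hom.ext (funext fun X ↦ funext fun i ↦ ?_)
  refine DirectSum.linearMap_ext _ fun a ↦ LinearMap.ext fun (x : (F a).obj X i) ↦ ?_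
  exact congrArg (fun δ : F a ⟶ G ↦ δ.app X i x) (h a)

lemma projective_sum {ι : Type w} (F : ι → GrFunctor.{w} K C) [∀ a, Projective (F a)] :
    Projective (sumFunctor F) where
  factors f e _ := ⟨sumDesc fun a ↦ Projective.factorThru (sumι F a ≫ f) e,
    sum_hom_ext fun a ↦ by rw [← Category.assoc, sumι_desc, Projective.factorThru_comp]⟩

variable [LocallySmall.{w} C]

/-- Precomposition with a homogeneous morphism. -/
def precompDeg (X : C) (m : ℤ) {Y Z : C} (f : Y ⟶ Z) (i j : ℤ) (hf : f ∈ homDeg K Y Z (j - i)) :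
    homDeg K Z X (i - m) →ₗ[K] homDeg K Y X (j - m) where
  toFun h := ⟨f ≫ h.1, homDeg_comp hf h.2⟩
  map_add' _ _ := Subtype.ext (Preadditive.comp_add _ _ _ _ _ _)
  map_smul' _ _ := Subtype.ext (Linear.comp_smul _ _ _ _ _ _)

/-- The shifted representable functor `Hom(-, X)[-m]`. -/
noncomputable def repFunctor (X : C) (m : ℤ) : GrFunctor.{w} K C where
  obj Y i := ModuleCat.of K (Shrink.{w} (homDeg K Y X (i - m)))
  map {Y Z} f i j hf := (Shrink.linearEquiv.{w} K (homDeg K Y X (j - m))).symm.toLinearMap ∘ₗ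
    precompDeg X m f i j hf ∘ₗ (Shrink.linearEquiv.{w} K (homDeg K Z X (i - m))).toLinearMap
  map_add f g i j hf hg := by
    refine LinearMap.ext fun x ↦ ?_
    refine ((Shrink.linearEquiv.{w} K _).symm.congr_arg ?_).trans (_root_.map_add _ _ _)
    exact Subtype.ext (Preadditive.add_comp _ _ _ _ _ _)
  map_smul c f i j hf := by
    refine LinearMap.ext fun x ↦ ?_
    refine ((Shrink.linearEquiv.{w} K _).symm.congr_arg ?_).trans
      (_root_.map_smul (Shrink.linearEquiv.{w} K _).symm c _)
    exact Subtype.ext (Linear.smul_comp _ _ _ _ _ _)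
  map_id Y i := by
    refine LinearMap.ext fun x ↦ ?_
    refine ((Shrink.linearEquiv.{w} K _).symm.congr_arg ?_).trans
      (LinearEquiv.symm_apply_apply (Shrink.linearEquiv.{w} K _) x)
    exact Subtype.ext (Category.id_comp _)
  map_comp f g i j l hf hg := by
    refine LinearMap.ext fun x ↦ ?_
    refine ((Shrink.linearEquiv.{w} K _).symm.congr_arg ?_)
    refine Subtype.ext ?_
    simp [precompDeg]

/-- The components of a shifted representable functor. -/
noncomputable def repEquiv (X : C) (m : ℤ) (Y : C) (i : ℤ) :
    (repFunctor.{w} (K := K) X m).obj Y i ≃ₗ[K] homDeg K Y X (i - m) :=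
  Shrink.linearEquiv.{w} K (homDeg K Y X (i - m))

lemma repEquiv_map (X : C) (m : ℤ) {Y Z : C} (f : Y ⟶ Z) (i j : ℤ)
    (hf : f ∈ homDeg K Y Z (j - i)) (h : (repFunctor.{w} (K := K) X m).obj Z i) :
    repEquiv X m Y j ((repFunctor X m).map f i j hf h) =
      precompDeg X m f i j hf (repEquiv X m Z i h) :=
  (repEquiv X m Y j).apply_symm_apply (precompDeg X m f i j hf (repEquiv X m Z i h))

/-- The morphism from a shifted representable functor given by an element. -/
noncomputable def repHom (F : GrFunctor.{w} K C) (X : C) (m : ℤ) (x : F.obj X m) :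
    repFunctor X m ⟶ F where
  app Y i :=
    ({ toFun := fun h ↦ F.map h.1 m i h.2 x
       map_add' := fun h h' ↦ LinearMap.congr_fun (F.map_add _ _ _ _ h.2 h'.2) x
       map_smul' := fun c h ↦ LinearMap.congr_fun (F.map_smul c _ _ _ h.2) x } :
      homDeg K Y X (i - m) →ₗ[K] F.obj Y i) ∘ₗ (repEquiv X m Y i).toLinearMap
  naturality {Y Z} f i j hf h := by
    simp only [LinearMap.comp_apply, LinearEquiv.coe_coe, repEquiv_map]
    exact LinearMap.congr_fun (F.map_comp f _ m i j hf _) x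

/-- The universal element of a shifted representable functor. -/
noncomputable def repGen (X : C) (m : ℤ) : (repFunctor.{w} (K := K) X m).obj X m :=
  (repEquiv X m X m).symm ⟨𝟙 X, homDeg_id X m⟩

lemma repHom_gen (F : GrFunctor.{w} K C) (X : C) (m : ℤ) (x : F.obj X m) :
    (repHom F X m x).app X m (repGen X m) = x := by
  simp only [repHom, repGen, LinearMap.comp_apply, LinearEquiv.coe_coe,
    LinearEquiv.apply_symm_apply]
  exact LinearMap.congr_fun (F.map_id X m) x

lemma repHom_ext {F : GrFunctor.{w} K C} {X : C} {m : ℤ} {β γ : repFunctor X m ⟶ F}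
    (h : β.app X m (repGen X m) = γ.app X m (repGen X m)) : β = γ := by
  ext Y i y
  have e : y = (repFunctor X m).map (repEquiv X m Y i y).1 m i (repEquiv X m Y i y).2
      (repGen X m) := by
    apply (repEquiv X m Y i).injective
    rw [repEquiv_map, repGen, LinearEquiv.apply_symm_apply]
    exact Subtype.ext (Category.comp_id _).symm
  rw [e, β.naturality, γ.naturality, h]

instance projective_rep (X : C) (m : ℤ) : Projective (repFunctor.{w} (K := K) X m) where
  factors {E G} f e _ := by
    obtain ⟨y, hy⟩ := surjective_of_epi e X m (f.app X m (repGen X m))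
    refine ⟨repHom E X m y, repHom_ext ?_⟩
    rw [comp_app, repHom_gen, hy]

end GrFunctor

namespace GrFunctor

variable {K : Type k} [Field K] {C : Type u} [Category.{v} C] [Preadditive C] [Linear K C]
  [GradedCategory K C]

/-- The element `F(φ₀)(y)`, where `φ₀` is the component of degree zero of `φ`, as a linear function
of the endomorphism `φ`. -/
noncomputable def zeroAct (F : GrFunctor.{w} K C) (Y : C) (j : ℤ) (y : F.obj Y j) :
    (Y ⟶ Y) →ₗ[K] F.obj Y j :=
  letI := (GradedCategory.isInternal (K := K) Y Y).chooseDecomposition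
  { toFun := fun φ ↦ F.map (DirectSum.decompose (homDeg K Y Y) φ 0).1 j j
      (homDeg_congr (by omega) (DirectSum.decompose (homDeg K Y Y) φ 0).2) y
    map_add' := fun φ ψ ↦ by
      rw [← LinearMap.add_apply, ← F.map_add]
      exact LinearMap.congr_fun (F.map_congr (by simp) _ _) y
    map_smul' := fun c φ ↦ by
      rw [RingHom.id_apply, ← LinearMap.smul_apply, ← F.map_smul]
      refine LinearMap.congr_fun (F.map_congr ?_ _ _) y
      rw [DirectSum.decompose_smul]
      rfl }

lemma zeroAct_of_mem (F : GrFunctor.{w} K C) (Y : C) (j : ℤ) (y : F.obj Y j) {φ : Y ⟶ Y}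
    (hφ : φ ∈ homDeg K Y Y 0) :
    zeroAct F Y j y φ = F.map φ j j (homDeg_congr (by omega) hφ) y := by
  let _ := (GradedCategory.isInternal (K := K) Y Y).chooseDecomposition
  exact LinearMap.congr_fun (F.map_congr (DirectSum.decompose_of_mem_same _ hφ) _ _) y

lemma zeroAct_of_mem_ne (F : GrFunctor.{w} K C) (Y : C) (j : ℤ) (y : F.obj Y j) {φ : Y ⟶ Y}
    {d : ℤ} (hφ : φ ∈ homDeg K Y Y d) (hd : d ≠ 0) : zeroAct F Y j y φ = 0 := by
  let _ := (GradedCategory.isInternal (K := K) Y Y).chooseDecomposition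
  have h0 : (0 : Y ⟶ Y) ∈ homDeg K Y Y (j - j) := zero_mem _
  refine (LinearMap.congr_fun (F.map_congr (DirectSum.decompose_of_mem_ne _ hφ hd) _ h0) y).trans ?_
  have := LinearMap.congr_fun (F.map_smul (0 : K) (0 : Y ⟶ Y) j j h0) y
  rw [F.map_congr (zero_smul K (0 : Y ⟶ Y)) _ h0, zero_smul] at this
  exact this

/-- A morphism that is surjective on all objects of a set of representatives of the isomorphism
classes is surjective. -/
lemma surjective_of_iso {E F : GrFunctor.{w} K C} (π : E ⟶ F) {Y Z : C} (e : Y ≅ Z)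
    (h : ∀ i, Function.Surjective (π.app Z i)) (j : ℤ) : Function.Surjective (π.app Y j) := by
  intro y
  have key : ∀ (f : Y ⟶ Z) (g : Z ⟶ Y), zeroAct F Y j y (f ≫ g) ∈ LinearMap.range (π.app Y j) := by
    intro f g
    have hf : f ∈ ⨆ d, homDeg K Y Z d := by
      rw [(GradedCategory.isInternal Y Z).submodule_iSup_eq_top]; trivial
    have hg : g ∈ ⨆ d, homDeg K Z Y d := by
      rw [(GradedCategory.isInternal Z Y).submodule_iSup_eq_top]; trivial
    induction hf using Submodule.iSup_induction' with
    | zero => rw [zero_comp, _root_.map_zero]; exact zero_mem _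
    | add f f' _ _ h h' => rw [Preadditive.add_comp, _root_.map_add]; exact add_mem h h'
    | mem d f hf =>
      induction hg using Submodule.iSup_induction' with
      | zero => rw [comp_zero, _root_.map_zero]; exact zero_mem _
      | add g g' _ _ h h' => rw [Preadditive.comp_add, _root_.map_add]; exact add_mem h h'
      | mem d' g hg =>
        by_cases hd : d + d' = 0
        · have hg' : g ∈ homDeg K Z Y ((j + d') - j) := homDeg_congr (by omega) hg
          have hf' : f ∈ homDeg K Y Z (j - (j + d')) := homDeg_congr (by omega) hf
          rw [zeroAct_of_mem F Y j y (homDeg_congr hd (GradedCategory.comp_mem hf hg)),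
            F.map_comp f g j (j + d') j hf' hg', LinearMap.comp_apply]
          obtain ⟨x, hx⟩ := h _ (F.map g j (j + d') hg' y)
          exact ⟨E.map f (j + d') j hf' x, by rw [π.naturality, hx]⟩
        · rw [zeroAct_of_mem_ne F Y j y (GradedCategory.comp_mem hf hg) hd]
          exact zero_mem _
  have := key e.hom e.inv
  rw [e.hom_inv_id, zeroAct_of_mem F Y j y (GradedCategory.id_mem Y), F.map_id] at this
  exact this

/-- Over an essentially small graded category there are enough projective graded functors. -/
instance [EssentiallySmall.{w} C] : EnoughProjectives (GrFunctor.{w} K C) where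
  presentation F := by
    let obj : SmallModel.{w} C → C := (equivSmallModel.{w} C).inverse.obj
    let ι := Σ (s : SmallModel.{w} C) (i : ℤ), F.obj (obj s) i
    let P : ι → GrFunctor.{w} K C := fun a ↦ repFunctor (obj a.1) a.2.1
    let π : sumFunctor P ⟶ F := sumDesc fun a ↦ repHom F (obj a.1) a.2.1 a.2.2
    have : Projective (sumFunctor P) := projective_sum P
    suffices h : ∀ Y j, Function.Surjective (π.app Y j) from
      have := epi_of_surjective π h
      ⟨{ p := sumFunctor P, f := π }⟩
    intro Y
    refine surjective_of_iso π ((equivSmallModel.{w} C).unitIso.app Y) fun i x ↦ ?_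
    let a : ι := ⟨(equivSmallModel.{w} C).functor.obj Y, i, x⟩
    refine ⟨(sumι P a).app _ i (repGen _ i), ?_⟩
    rw [← comp_app]
    exact (congrArg (fun δ : P a ⟶ F ↦ δ.app _ i (repGen _ i)) (sumι_desc _ a)).trans
      (repHom_gen F _ i x)

end GrFunctor

/-! ### Tensor products, `Tor`, flatness, boundedness -/

namespace GrFunctor

variable {K : Type k} [Field K] {C : Type u} [Category.{v} C] [Preadditive C] [Linear K C]
  [GradedCategory K C]

/-- The degree `n` part of `∐_X G(X) ⊗_K F(X)`. -/
abbrev TensorPre (G : GrFunctor.{w} K Cᵒᵖ) (F : GrFunctor.{w} K C) (n : ℤ) : Type (max u w) :=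
  ⨁ p : C × ℤ, G.obj (Opposite.op p.1) p.2 ⊗[K] F.obj p.1 (n - p.2)

open Classical in
/-- The relations `G(f)(g) ⊗ x = g ⊗ F(f)(x)` for `f : X ⟶ Y`, `g ∈ G(X)` and `x ∈ F(Y)`
homogeneous. -/
noncomputable def tensorRel (G : GrFunctor.{w} K Cᵒᵖ) (F : GrFunctor.{w} K C) (n : ℤ) :
    Submodule K (TensorPre G F n) :=
  Submodule.span K {z | ∃ (X Y : C) (f : X ⟶ Y) (i j : ℤ) (hf : f ∈ homDeg K X Y (j - i))
    (g : G.obj (Opposite.op X) i) (x : F.obj Y (n - j)),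
    z = DirectSum.lof K (C × ℤ)
          (fun p ↦ G.obj (Opposite.op p.1) p.2 ⊗[K] F.obj p.1 (n - p.2)) (Y, j)
          (G.map f.op i j (homDeg_op hf) g ⊗ₜ x) -
        DirectSum.lof K (C × ℤ)
          (fun p ↦ G.obj (Opposite.op p.1) p.2 ⊗[K] F.obj p.1 (n - p.2)) (X, i)
          (g ⊗ₜ F.map f (n - j) (n - i) (homDeg_congr (by omega) hf) x)}

/-- The degree `n` part of the tensor product `G ⊗_C F` of a covariant graded functor `G`
(an object of `Gr(Cᵒᵖ)`) and a contravariant graded functor `F`. -/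
abbrev TensorDeg (G : GrFunctor.{w} K Cᵒᵖ) (F : GrFunctor.{w} K C) (n : ℤ) : Type (max u w) :=
  TensorPre G F n ⧸ tensorRel G F n

/-- The map induced on `∐_X G(X) ⊗_K F(X)`. -/
noncomputable def tensorPreMap {G G' : GrFunctor.{w} K Cᵒᵖ} {F F' : GrFunctor.{w} K C}
    (α : G ⟶ G') (β : F ⟶ F') (n : ℤ) : TensorPre G F n →ₗ[K] TensorPre G' F' n :=
  DirectSum.lmap fun p ↦
    TensorProduct.map (α.app (Opposite.op p.1) p.2) (β.app p.1 (n - p.2))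

lemma tensorPreMap_rel {G G' : GrFunctor.{w} K Cᵒᵖ} {F F' : GrFunctor.{w} K C}
    (α : G ⟶ G') (β : F ⟶ F') (n : ℤ) :
    tensorRel G F n ≤ (tensorRel G' F' n).comap (tensorPreMap α β n) := by
  classical
  refine Submodule.span_le.2 ?_
  rintro _ ⟨X, Y, f, i, j, hf, g, x, rfl⟩
  refine Submodule.subset_span
    ⟨X, Y, f, i, j, hf, α.app _ i g, β.app Y (n - j) x, ?_⟩
  rw [_root_.map_sub, tensorPreMap, DirectSum.lmap_lof, DirectSum.lmap_lof]
  simp only [TensorProduct.map_tmul, α.naturality, β.naturality]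

/-- The map `α ⊗ β` in degree `n`. -/
noncomputable def tensorMap {G G' : GrFunctor.{w} K Cᵒᵖ} {F F' : GrFunctor.{w} K C}
    (α : G ⟶ G') (β : F ⟶ F') (n : ℤ) : TensorDeg G F n →ₗ[K] TensorDeg G' F' n :=
  Submodule.mapQ _ _ (tensorPreMap α β n) (tensorPreMap_rel α β n)

/-- The degree `n` part of the functor `G ⊗_C -`. -/
noncomputable def tensorLeft (G : GrFunctor.{w} K Cᵒᵖ) (n : ℤ) :
    GrFunctor.{w} K C ⥤ ModuleCat.{max u w} K where
  obj F := ModuleCat.of K (TensorDeg G F n)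
  map β := ModuleCat.ofHom (tensorMap (𝟙 G) β n)
  map_id F := by
    classical
    refine ModuleCat.hom_ext (Submodule.linearMap_qext _ (DirectSum.linearMap_ext _ fun p ↦
      TensorProduct.ext' fun g x ↦ ?_))
    simp [tensorMap, tensorPreMap, DirectSum.lmap_lof]
  map_comp β γ := by
    classical
    refine ModuleCat.hom_ext (Submodule.linearMap_qext _ (DirectSum.linearMap_ext _ fun p ↦
      TensorProduct.ext' fun g x ↦ ?_))
    simp [tensorMap, tensorPreMap, DirectSum.lmap_lof]

lemma tensorMap_add {G G' : GrFunctor.{w} K Cᵒᵖ} {F F' : GrFunctor.{w} K C}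
    (α : G ⟶ G') (β γ : F ⟶ F') (n : ℤ) :
    tensorMap α (β + γ) n = tensorMap α β n + tensorMap α γ n := by
  classical
  refine Submodule.linearMap_qext _ (DirectSum.linearMap_ext _ fun p ↦
    TensorProduct.ext' fun g x ↦ ?_)
  simp [tensorMap, tensorPreMap, DirectSum.lmap_lof, TensorProduct.tmul_add]

instance (G : GrFunctor.{w} K Cᵒᵖ) (n : ℤ) : (tensorLeft G n).Additive where
  map_add {_ _ β γ} := ModuleCat.hom_ext (tensorMap_add (𝟙 G) β γ n)

/-- The tensor product `G ⊗_C F` is zero. -/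
def TensorIsZero (G : GrFunctor.{w} K Cᵒᵖ) (F : GrFunctor.{w} K C) : Prop :=
  ∀ n : ℤ, Subsingleton (TensorDeg G F n)

/-- The degree `n` part of `Tor_i(G, F)`, where `Tor_i(G, -)` is the `i`-th left derived functor of
`G ⊗_C -`. -/
noncomputable def torDeg [EssentiallySmall.{w} C] (i : ℕ) (G : GrFunctor.{w} K Cᵒᵖ)
    (F : GrFunctor.{w} K C) (n : ℤ) : ModuleCat.{max u w} K :=
  ((tensorLeft G n).leftDerived i).obj F

/-- The graded vector space `Tor_i(G, F)` is zero. -/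
def TorIsZero [EssentiallySmall.{w} C] (i : ℕ) (G : GrFunctor.{w} K Cᵒᵖ)
    (F : GrFunctor.{w} K C) : Prop :=
  ∀ n : ℤ, Subsingleton (torDeg i G F n)

/-- A graded functor `F` is flat if `- ⊗_C F` is exact, that is (as the tensor product is right
exact), if it preserves monomorphisms. -/
def IsFlat (F : GrFunctor.{w} K C) : Prop :=
  ∀ (G G' : GrFunctor.{w} K Cᵒᵖ) (α : G ⟶ G') [Mono α] (n : ℤ),
    Function.Injective (tensorMap α (𝟙 F) n)

/-- A graded functor `F` is bounded below if there is an integer `N` with `F(X)_i = 0` for all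
objects `X` and all `i < N`. -/
def IsBoundedBelow (F : GrFunctor.{w} K C) : Prop :=
  ∃ N : ℤ, ∀ (X : C) (i : ℤ), i < N → Subsingleton (F.obj X i)

end GrFunctor

-- The proof is Nakayama's lemma together with minimal projective covers, with induction on the
-- degree in place of a finiteness condition. Call an object local if its endomorphism ring is
-- graded local. The hypothesis on the radical makes the degree zero part semisimple: a nonzero
-- morphism of degree zero between local objects is invertible (`exists_inverse`). Hence, for local
-- Z, the quotient S_Z of Hom(Z, -) by its part of positive degree is simple (`simple_topFunctor`),
-- and S_Z ⊗ F is F(Z) modulo the images of morphisms of positive degree.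
--
-- For (a): if F vanishes below degree n, nothing of positive degree reaches F(Z)_n, so this space
-- survives in S_Z ⊗ F and must be zero. The Krull-Schmidt property passes from local objects to all
-- objects, and one climbs degree by degree from the lower bound (`isZero_of_tensorIsZero`).
--
-- For (b): a maximal set of homogeneous elements of F that is independent modulo the radical
-- defines a sum P of shifted representables and a map P ⟶ F. Maximality and the lower bound make it
-- epi (`epi_coverπ`); independence puts its kernel into the radical of P at local objects
-- (`mem_radSub_of_coverπ_eq_zero`). So S_Z ⊗ - kills the kernel inclusion. If Tor_1(S_Z, F) = 0,
-- the kernel inclusion of some projective presentation stays injective under S_Z ⊗ -; comparing the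
-- two presentations gives S_Z ⊗ ker = 0 (`tensorIsZero_kernel`), and (a), applied to the bounded
-- below kernel, makes P ⟶ F an isomorphism.
--
-- The flat case and (c) require a transfer of information from the first variable of the tensor
-- product to the second. Balancing of Tor is replaced by one diagram chase
-- (`tensorMap_kernelι_injective`), which rests on the flatness of projectives. `SyzygyInjective m G
-- F` plays the role of Tor_{m+1}(G, F) = 0; it follows from projective dimension at most m of G,
-- and (b) is then applied to the m-th syzygy of F.

universe x

/-! ### The degree zero part of a positively graded category -/

section DegreeZero

variable (K : Type k) [Field K] {C : Type u} [Category.{v} C] [Preadditive C] [Linear K C]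
  [GradedCategory K C]

/-- The component of degree zero of a morphism. -/
noncomputable def zeroPart (X Y : C) : (X ⟶ Y) →ₗ[K] (X ⟶ Y) :=
  letI := (GradedCategory.isInternal (K := K) X Y).chooseDecomposition
  { toFun := fun f ↦ (DirectSum.decompose (homDeg K X Y) f 0).1
    map_add' := fun f g ↦ by simp
    map_smul' := fun c f ↦ by rw [DirectSum.decompose_smul]; rfl }

lemma zeroPart_mem {X Y : C} (f : X ⟶ Y) : zeroPart K X Y f ∈ homDeg K X Y 0 := by
  let _ := (GradedCategory.isInternal (K := K) X Y).chooseDecomposition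
  exact (DirectSum.decompose (homDeg K X Y) f 0).2

variable {K}

lemma zeroPart_of_mem {X Y : C} {f : X ⟶ Y} (hf : f ∈ homDeg K X Y 0) :
    zeroPart K X Y f = f := by
  let _ := (GradedCategory.isInternal (K := K) X Y).chooseDecomposition
  exact DirectSum.decompose_of_mem_same _ hf

lemma zeroPart_of_mem_ne {X Y : C} {f : X ⟶ Y} {i : ℤ} (hf : f ∈ homDeg K X Y i) (hi : i ≠ 0) :
    zeroPart K X Y f = 0 := by
  let _ := (GradedCategory.isInternal (K := K) X Y).chooseDecomposition
  exact DirectSum.decompose_of_mem_ne _ hf hi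

lemma homDeg_induction {X Y : C} {p : (X ⟶ Y) → Prop}
    (mem : ∀ i, ∀ f ∈ homDeg K X Y i, p f) (zero : p 0) (add : ∀ f g, p f → p g → p (f + g))
    (f : X ⟶ Y) : p f := by
  have hf : f ∈ ⨆ i, homDeg K X Y i := by
    rw [(GradedCategory.isInternal X Y).submodule_iSup_eq_top]; trivial
  exact Submodule.iSup_induction _ (motive := p) hf mem zero add

lemma mem_positivePart_of_mem {X Y : C} {f : X ⟶ Y} {i : ℤ} (hi : 1 ≤ i)
    (hf : f ∈ homDeg K X Y i) : f ∈ positivePart K X Y :=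
  Submodule.mem_iSup_of_mem i (Submodule.mem_iSup_of_mem hi hf)

variable (hpos : IsPositivelyGraded K C)
include hpos

lemma homDeg_eq_zero {X Y : C} {f : X ⟶ Y} {i : ℤ} (hi : i < 0) (hf : f ∈ homDeg K X Y i) :
    f = 0 := by
  rw [hpos X Y i hi] at hf
  exact hf

lemma sub_zeroPart_mem {X Y : C} (f : X ⟶ Y) : f - zeroPart K X Y f ∈ positivePart K X Y := by
  refine homDeg_induction (K := K) (p := fun f ↦ f - zeroPart K X Y f ∈ positivePart K X Y)
    (fun i f hf ↦ ?_) (by simp) (fun f g hf hg ↦ ?_) f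
  · rcases lt_trichotomy i 0 with hi | rfl | hi
    · simp [homDeg_eq_zero hpos hi hf]
    · simp [zeroPart_of_mem hf]
    · rw [zeroPart_of_mem_ne hf hi.ne', sub_zero]
      exact mem_positivePart_of_mem hi hf
  · rw [map_add, add_sub_add_comm]
    exact add_mem hf hg

omit hpos in
lemma zeroPart_of_mem_positivePart {X Y : C} {f : X ⟶ Y} (hf : f ∈ positivePart K X Y) :
    zeroPart K X Y f = 0 := by
  have : positivePart K X Y ≤ LinearMap.ker (zeroPart K X Y) :=
    iSup₂_le fun i hi f hf ↦ zeroPart_of_mem_ne hf (by omega)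
  exact this hf

lemma mem_positivePart_iff {X Y : C} {f : X ⟶ Y} :
    f ∈ positivePart K X Y ↔ zeroPart K X Y f = 0 := by
  refine ⟨zeroPart_of_mem_positivePart, fun h ↦ ?_⟩
  simpa [h] using sub_zeroPart_mem hpos f

/-- Two degrees that are both nonnegative add up to zero only if both are zero, so the cross terms
do not contribute. Positivity of the grading is essential here; it allows inhomogeneous isomorphisms
and inverses to be replaced by ones of degree zero. -/
lemma zeroPart_comp {X Y Z : C} (f : X ⟶ Y) (g : Y ⟶ Z) :
    zeroPart K X Z (f ≫ g) = zeroPart K X Y f ≫ zeroPart K Y Z g := by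
  refine homDeg_induction (K := K)
    (p := fun f ↦ zeroPart K X Z (f ≫ g) = zeroPart K X Y f ≫ zeroPart K Y Z g)
    (fun i f hf ↦ ?_) (by simp)
    (fun f f' h h' ↦ by simp only [Preadditive.add_comp, map_add, h, h']) f
  refine homDeg_induction (K := K)
    (p := fun g ↦ zeroPart K X Z (f ≫ g) = zeroPart K X Y f ≫ zeroPart K Y Z g)
    (fun j g hg ↦ ?_) (by simp)
    (fun g g' h h' ↦ by simp only [Preadditive.comp_add, map_add, h, h']) g
  have hfg := GradedCategory.comp_mem hf hg
  rcases lt_trichotomy i 0 with hi | rfl | hi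
  · simp [homDeg_eq_zero hpos hi hf]
  · rcases eq_or_ne j 0 with rfl | hj
    · rw [zeroPart_of_mem hf, zeroPart_of_mem hg, zeroPart_of_mem hfg]
    · rw [zeroPart_of_mem_ne hg hj, zeroPart_of_mem_ne hfg (by omega), comp_zero]
  · rcases lt_or_ge j 0 with hj | hj
    · simp [homDeg_eq_zero hpos hj hg]
    · rw [zeroPart_of_mem_ne hf hi.ne', zeroPart_of_mem_ne hfg (by omega), zero_comp]

/-- The degree zero part of an isomorphism. -/
noncomputable def isoZeroPart {X Y : C} (e : X ≅ Y) : X ≅ Y where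
  hom := zeroPart K X Y e.hom
  inv := zeroPart K Y X e.inv
  hom_inv_id := by
    rw [← zeroPart_comp hpos, e.hom_inv_id, zeroPart_of_mem (GradedCategory.id_mem X)]
  inv_hom_id := by
    rw [← zeroPart_comp hpos, e.inv_hom_id, zeroPart_of_mem (GradedCategory.id_mem Y)]

/-- In a positively graded Krull-Schmidt category, every identity is a sum of morphisms of degree
zero that factor through objects with graded local endomorphism rings. -/
lemma exists_decomposition [HasFiniteBiproducts C] (hKS : IsGradedKrullSchmidt K C) (X : C) :
    ∃ (n : ℕ) (Z : Fin n → C) (q : ∀ a, X ⟶ Z a) (p : ∀ a, Z a ⟶ X),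
      (∀ a, HasGradedLocalEnd K (Z a)) ∧ (∀ a, q a ∈ homDeg K X (Z a) 0) ∧
      (∀ a, p a ∈ homDeg K (Z a) X 0) ∧ ∑ a, q a ≫ p a = 𝟙 X := by
  obtain ⟨n, Z, hZ, ⟨e⟩⟩ := hKS X
  -- The isomorphism `e` need not be homogeneous. Its composites with projections and inclusions are
  -- cut down to degree zero, and multiplicativity of `zeroPart` preserves the decomposition of the
  -- identity.
  refine ⟨n, Z, fun a ↦ zeroPart K _ _ (e.hom ≫ biproduct.π Z a),
    fun a ↦ zeroPart K _ _ (biproduct.ι Z a ≫ e.inv), hZ, fun a ↦ zeroPart_mem K _,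
    fun a ↦ zeroPart_mem K _, ?_⟩
  simp_rw [← zeroPart_comp hpos]
  rw [← map_sum]
  have : ∑ a, (e.hom ≫ biproduct.π Z a) ≫ biproduct.ι Z a ≫ e.inv = 𝟙 X := by
    have h := biproduct.total (f := Z)
    calc _ = e.hom ≫ (∑ a, biproduct.π Z a ≫ biproduct.ι Z a) ≫ e.inv := by
          simp only [Preadditive.sum_comp, Preadditive.comp_sum, Category.assoc]
      _ = _ := by rw [h, Category.id_comp, e.hom_inv_id]
  rw [this, zeroPart_of_mem (GradedCategory.id_mem X)]

/-! ### Degree zero morphisms and graded local endomorphism rings -/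

variable (hrad : ∀ X Y : C, gradedRadical K X Y = (positivePart K X Y : Set (X ⟶ Y)))
include hrad

omit hpos in
/-- The maximal graded left ideal of a graded local endomorphism ring is its positive part. -/
lemma mem_maximal_iff {Z : C} {M : Ideal (End Z)} (hM : IsMaximalGradedIdeal K M)
    (huniq : ∀ I, IsMaximalGradedIdeal K I → I = M) {f : Z ⟶ Z} :
    End.of f ∈ M ↔ f ∈ positivePart K Z Z := by
  have hR : gradedEndRadical K Z = M := by
    rw [gradedEndRadical, show {I | IsMaximalGradedIdeal K I} = {M} from
      Set.eq_singleton_iff_unique_mem.2 ⟨hM, huniq⟩, sInf_singleton]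
  change _ ↔ f ∈ (positivePart K Z Z : Set (Z ⟶ Z))
  rw [← hrad, gradedRadical, Set.mem_ofPred_eq, hR]
  refine ⟨fun h g ↦ M.mul_mem_left (End.of g) h, fun h ↦ ?_⟩
  simpa using h (𝟙 Z)

omit hpos in
lemma mem_gradedEndRadical_iff {Z : C} (hZ : HasGradedLocalEnd K Z) {f : Z ⟶ Z} :
    End.of f ∈ gradedEndRadical K Z ↔ f ∈ positivePart K Z Z := by
  obtain ⟨M, hM, huniq⟩ := hZ
  rw [gradedEndRadical, show {I | IsMaximalGradedIdeal K I} = {M} from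
      Set.eq_singleton_iff_unique_mem.2 ⟨hM, huniq⟩, sInf_singleton]
  exact mem_maximal_iff hrad hM huniq

omit hpos hrad in
lemma id_ne_zero_of_local {Z : C} (hZ : HasGradedLocalEnd K Z) : 𝟙 Z ≠ 0 := by
  obtain ⟨M, hM, -⟩ := hZ
  intro h
  refine hM.prop.2 ((Ideal.eq_top_iff_one M).2 ?_)
  have : (1 : End Z) = 0 := h
  rw [this]
  exact zero_mem _

/-- A nonzero endomorphism of degree zero of an object with graded local endomorphism ring is
a split monomorphism. -/
lemma exists_comp_eq_id_of_local {Z : C} (hZ : HasGradedLocalEnd K Z) {f : Z ⟶ Z}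
    (hf : f ∈ homDeg K Z Z 0) (hf0 : f ≠ 0) : ∃ g ∈ homDeg K Z Z 0, f ≫ g = 𝟙 Z := by
  obtain ⟨M, hM, huniq⟩ := hZ
  -- The element `f` is not in `M`, whose elements have no component of degree zero. So the graded
  -- ideal `J` is everything, and the degree zero component of 1 = m + g * f yields the required
  -- morphism.
  let J : Ideal (End Z) := M ⊔ Ideal.span {End.of f}
  have hfJ : End.of f ∈ J := Ideal.mem_sup_right (Ideal.mem_span_singleton_self _)
  have hJ : IsGradedIdeal K J := by
    refine le_antisymm (sup_le ?_ ?_) (Ideal.span_le.2 fun a ha ↦ ha.1)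
    · rw [hM.prop.1]
      exact Ideal.span_mono fun a ha ↦ ⟨Ideal.mem_sup_left ha.1, ha.2⟩
    · rw [Ideal.span_singleton_le_iff_mem]
      exact Ideal.subset_span ⟨hfJ, 0, hf⟩
  have htop : J = ⊤ := by
    by_contra hne
    have : End.of f ∈ M := hM.le_of_ge ⟨hJ, hne⟩ le_sup_left hfJ
    rw [mem_maximal_iff hrad hM huniq, mem_positivePart_iff hpos, zeroPart_of_mem hf] at this
    exact hf0 this
  have h1 : (1 : End Z) ∈ J := by rw [htop]; trivial
  obtain ⟨m, hm, y, hy, hmy⟩ := Submodule.mem_sup.1 h1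
  obtain ⟨g, rfl⟩ := Ideal.mem_span_singleton'.1 hy
  have hm' : zeroPart K Z Z m.asHom = 0 :=
    (mem_positivePart_iff hpos).1 ((mem_maximal_iff hrad hM huniq).1 hm)
  refine ⟨zeroPart K Z Z g.asHom, zeroPart_mem K _, ?_⟩
  have h2 : m.asHom + f ≫ g.asHom = 𝟙 Z := hmy
  have := congrArg (zeroPart K Z Z) h2
  rwa [map_add, hm', zero_add, zeroPart_comp hpos, zeroPart_of_mem hf,
    zeroPart_of_mem (GradedCategory.id_mem Z)] at this

/-- A nonzero morphism of degree zero from an object with graded local endomorphism ring is a split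
monomorphism. -/
lemma exists_comp_eq_id {Z X : C} (hZ : HasGradedLocalEnd K Z) {f : Z ⟶ X}
    (hf : f ∈ homDeg K Z X 0) (hf0 : f ≠ 0) : ∃ g ∈ homDeg K X Z 0, f ≫ g = 𝟙 Z := by
  -- Outside the radical there is a return morphism `g` with `f ≫ g` outside the radical of End Z,
  -- i.e. with nonzero degree zero part; this reduces to endomorphisms of `Z`.
  have h1 : f ∉ gradedRadical K Z X := by
    rw [hrad]
    intro h
    rw [SetLike.mem_coe, mem_positivePart_iff hpos, zeroPart_of_mem hf] at h
    exact hf0 h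
  simp only [gradedRadical, Set.mem_ofPred_eq, not_forall] at h1
  obtain ⟨g, hg⟩ := h1
  rw [mem_gradedEndRadical_iff hrad hZ, mem_positivePart_iff hpos, zeroPart_comp hpos,
    zeroPart_of_mem hf] at hg
  obtain ⟨φ, hφ, h⟩ := exists_comp_eq_id_of_local hpos hrad hZ
    (GradedCategory.comp_mem hf (zeroPart_mem K g)) hg
  exact ⟨zeroPart K _ _ g ≫ φ, GradedCategory.comp_mem (zeroPart_mem K g) hφ, by simpa using h⟩

/-- A nonzero morphism of degree zero between objects with graded local endomorphism rings has an
inverse of degree zero. -/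
lemma exists_inverse {Z X : C} (hZ : HasGradedLocalEnd K Z) (hX : HasGradedLocalEnd K X)
    {f : Z ⟶ X} (hf : f ∈ homDeg K Z X 0) (hf0 : f ≠ 0) :
    ∃ g ∈ homDeg K X Z 0, f ≫ g = 𝟙 Z ∧ g ≫ f = 𝟙 X := by
  obtain ⟨g, hg, hfg⟩ := exists_comp_eq_id hpos hrad hZ hf hf0
  -- The composite in the other order is a nonzero idempotent of degree zero on `X`. It has a right
  -- inverse `ψ` because End X is graded local, and an idempotent with a right inverse is the
  -- identity.
  have hne : g ≫ f ≠ 0 := fun h ↦ hf0 <| by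
    rw [← Category.id_comp f, ← hfg, Category.assoc, h, comp_zero]
  obtain ⟨ψ, -, hψ⟩ := exists_comp_eq_id_of_local hpos hrad hX (GradedCategory.comp_mem hg hf) hne
  refine ⟨g, hg, hfg, ?_⟩
  have hidem : (g ≫ f) ≫ g ≫ f = g ≫ f := by simp [reassoc_of% hfg]
  calc g ≫ f = (g ≫ f) ≫ (g ≫ f) ≫ ψ := by rw [hψ, Category.comp_id]
    _ = 𝟙 X := by rw [← Category.assoc, hidem, hψ]

end DegreeZero

/-! ### Elements of tensor products and right exactness -/

namespace GrFunctor

variable {K : Type k} [Field K] {C : Type u} [Category.{v} C] [Preadditive C] [Linear K C]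
  [GradedCategory K C]

open Classical in
/-- The class of a pure tensor. -/
noncomputable def tmul (G : GrFunctor.{w} K Cᵒᵖ) (F : GrFunctor.{w} K C) (n : ℤ) (Y : C) (i : ℤ) :
    G.obj (Opposite.op Y) i →ₗ[K] F.obj Y (n - i) →ₗ[K] TensorDeg G F n :=
  LinearMap.compr₂ (TensorProduct.mk K _ _) ((tensorRel G F n).mkQ ∘ₗ DirectSum.lof K (C × ℤ)
    (fun p ↦ G.obj (Opposite.op p.1) p.2 ⊗[K] F.obj p.1 (n - p.2)) (Y, i))

section

variable {G G' : GrFunctor.{w} K Cᵒᵖ} {F F' : GrFunctor.{w} K C} {n : ℤ}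

lemma tmul_map {X Y : C} (f : X ⟶ Y) (i j : ℤ) (hf : f ∈ homDeg K X Y (j - i))
    (g : G.obj (Opposite.op X) i) (x : F.obj Y (n - j)) :
    tmul G F n Y j (G.map f.op i j (homDeg_op hf) g) x =
      tmul G F n X i g (F.map f (n - j) (n - i) (homDeg_congr (by omega) hf) x) := by
  classical
  refine (Submodule.Quotient.eq _).2 (Submodule.subset_span ?_)
  exact ⟨X, Y, f, i, j, hf, g, x, rfl⟩

lemma tensorMap_tmul (α : G ⟶ G') (β : F ⟶ F') (Y : C) (i : ℤ) (g : G.obj (Opposite.op Y) i)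
    (x : F.obj Y (n - i)) :
    tensorMap α β n (tmul G F n Y i g x) = tmul G' F' n Y i (α.app _ i g) (β.app Y _ x) := by
  classical
  simp only [tensorMap, tmul, tensorPreMap, LinearMap.compr₂_apply, LinearMap.comp_apply,
    Submodule.mkQ_apply, Submodule.mapQ_apply, DirectSum.lmap_lof, TensorProduct.mk_apply,
    TensorProduct.map_tmul]

lemma tensor_induction {p : TensorDeg G F n → Prop} (zero : p 0)
    (add : ∀ z z', p z → p z' → p (z + z')) (h : ∀ Y i g x, p (tmul G F n Y i g x))
    (z : TensorDeg G F n) : p z := by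
  classical
  obtain ⟨z, rfl⟩ := Submodule.mkQ_surjective _ z
  induction z using DirectSum.induction_on with
  | zero => rw [_root_.map_zero]; exact zero
  | add z z' hz hz' => rw [_root_.map_add]; exact add _ _ hz hz'
  | of a t =>
    induction t using TensorProduct.induction_on with
    | zero => rw [_root_.map_zero, _root_.map_zero]; exact zero
    | add t t' ht ht' => rw [_root_.map_add, _root_.map_add]; exact add _ _ ht ht'
    | tmul g x => exact h a.1 a.2 g x

lemma tensor_hom_ext {M : Type*} [AddCommGroup M] [Module K M] {φ ψ : TensorDeg G F n →ₗ[K] M}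
    (h : ∀ Y i g x, φ (tmul G F n Y i g x) = ψ (tmul G F n Y i g x)) : φ = ψ :=
  LinearMap.ext fun z ↦ tensor_induction (p := fun z ↦ φ z = ψ z) (by simp)
    (fun _ _ h h' ↦ by rw [_root_.map_add, _root_.map_add, h, h']) h z

open Classical in
lemma tensorRel_le_ker {M : Type*} [AddCommGroup M] [Module K M]
    (φ : ∀ Y i, G.obj (Opposite.op Y) i →ₗ[K] F.obj Y (n - i) →ₗ[K] M)
    (hφ : ∀ {X Y : C} (f : X ⟶ Y) (i j : ℤ) (hf : f ∈ homDeg K X Y (j - i))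
      (g : G.obj (Opposite.op X) i) (x : F.obj Y (n - j)),
      φ Y j (G.map f.op i j (homDeg_op hf) g) x =
        φ X i g (F.map f (n - j) (n - i) (homDeg_congr (by omega) hf) x)) :
    tensorRel G F n ≤ LinearMap.ker
      (DirectSum.toModule K (C × ℤ) M fun p ↦ TensorProduct.lift (φ p.1 p.2)) := by
  refine Submodule.span_le.2 ?_
  rintro _ ⟨X, Y, f, i, j, hf, g, x, rfl⟩
  rw [SetLike.mem_coe, LinearMap.mem_ker, _root_.map_sub, DirectSum.toModule_lof,
    DirectSum.toModule_lof, TensorProduct.lift.tmul, TensorProduct.lift.tmul, hφ f i j hf,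
    sub_self]

open Classical in
/-- The linear map out of a tensor product given by a balanced family of bilinear maps. -/
noncomputable def tensorLift {M : Type*} [AddCommGroup M] [Module K M]
    (φ : ∀ Y i, G.obj (Opposite.op Y) i →ₗ[K] F.obj Y (n - i) →ₗ[K] M)
    (hφ : ∀ {X Y : C} (f : X ⟶ Y) (i j : ℤ) (hf : f ∈ homDeg K X Y (j - i))
      (g : G.obj (Opposite.op X) i) (x : F.obj Y (n - j)),
      φ Y j (G.map f.op i j (homDeg_op hf) g) x =
        φ X i g (F.map f (n - j) (n - i) (homDeg_congr (by omega) hf) x)) :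
    TensorDeg G F n →ₗ[K] M :=
  (tensorRel G F n).liftQ
    (DirectSum.toModule K (C × ℤ) M fun p ↦ TensorProduct.lift (φ p.1 p.2))
    (tensorRel_le_ker φ hφ)

lemma tensorLift_tmul {M : Type*} [AddCommGroup M] [Module K M]
    (φ : ∀ Y i, G.obj (Opposite.op Y) i →ₗ[K] F.obj Y (n - i) →ₗ[K] M)
    (hφ : ∀ {X Y : C} (f : X ⟶ Y) (i j : ℤ) (hf : f ∈ homDeg K X Y (j - i))
      (g : G.obj (Opposite.op X) i) (x : F.obj Y (n - j)),
      φ Y j (G.map f.op i j (homDeg_op hf) g) x =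
        φ X i g (F.map f (n - j) (n - i) (homDeg_congr (by omega) hf) x))
    (Y : C) (i : ℤ) (g : G.obj (Opposite.op Y) i) (x : F.obj Y (n - i)) :
    tensorLift φ hφ (tmul G F n Y i g x) = φ Y i g x := by
  classical
  have h := DirectSum.toModule_lof (ι := C × ℤ) K
    (M := fun p ↦ G.obj (Opposite.op p.1) p.2 ⊗[K] F.obj p.1 (n - p.2))
    (φ := fun p ↦ TensorProduct.lift (φ p.1 p.2)) (Y, i) (g ⊗ₜ x)
  rw [TensorProduct.lift.tmul] at h
  exact h

end

lemma tensorMap_id (G : GrFunctor.{w} K Cᵒᵖ) (F : GrFunctor.{w} K C) (n : ℤ) :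
    tensorMap (𝟙 G) (𝟙 F) n = LinearMap.id :=
  tensor_hom_ext fun Y i g x ↦ by simp [tensorMap_tmul]

lemma tensorMap_comp {G G' G'' : GrFunctor.{w} K Cᵒᵖ} {F F' F'' : GrFunctor.{w} K C}
    (α : G ⟶ G') (α' : G' ⟶ G'') (β : F ⟶ F') (β' : F' ⟶ F'') (n : ℤ) :
    tensorMap (α ≫ α') (β ≫ β') n = tensorMap α' β' n ∘ₗ tensorMap α β n :=
  tensor_hom_ext fun Y i g x ↦ by simp [tensorMap_tmul]

lemma tensorMap_comp_apply {G G' G'' : GrFunctor.{w} K Cᵒᵖ} {F F' F'' : GrFunctor.{w} K C}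
    (α : G ⟶ G') (α' : G' ⟶ G'') (β : F ⟶ F') (β' : F' ⟶ F'') (n : ℤ) (z : TensorDeg G F n) :
    tensorMap α' β' n (tensorMap α β n z) = tensorMap (α ≫ α') (β ≫ β') n z := by
  rw [tensorMap_comp]; rfl

lemma tensorMap_surjective {G G' : GrFunctor.{w} K Cᵒᵖ} {F F' : GrFunctor.{w} K C}
    (α : G ⟶ G') (β : F ⟶ F') [Epi α] [Epi β] (n : ℤ) :
    Function.Surjective (tensorMap α β n) := by
  rw [← LinearMap.range_eq_top, eq_top_iff]
  rintro z -
  induction z using tensor_induction with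
  | zero => exact zero_mem _
  | add z z' h h' => exact add_mem h h'
  | h Y i g x =>
    obtain ⟨g, rfl⟩ := surjective_of_epi α _ i g
    obtain ⟨x, rfl⟩ := surjective_of_epi β Y _ x
    exact ⟨_, tensorMap_tmul α β Y i g x⟩

/-- If the tensor products of vector spaces are exact, then so are the tensor products of graded
functors, provided that the second pair of morphisms is epi. -/
lemma tensorMap_exact {G G' G'' : GrFunctor.{w} K Cᵒᵖ} {F F' F'' : GrFunctor.{w} K C}
    (α : G ⟶ G') (α' : G' ⟶ G'') (β : F ⟶ F') (β' : F' ⟶ F'') [Epi α'] [Epi β'] (n : ℤ)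
    (h : ∀ Y i, Function.Exact (TensorProduct.map (α.app (Opposite.op Y) i) (β.app Y (n - i)))
      (TensorProduct.map (α'.app (Opposite.op Y) i) (β'.app Y (n - i)))) :
    Function.Exact (tensorMap α β n) (tensorMap α' β' n) := by
  classical
  have hpre : LinearMap.ker (tensorPreMap α' β' n) = LinearMap.range (tensorPreMap α β n) := by
    rw [tensorPreMap, tensorPreMap, DirectSum.ker_lmap, DirectSum.range_lmap]
    congr! 3 with p
    exact (h p.1 p.2).linearMap_ker_eq
  -- Since `α'` and `β'` are surjective, every defining relation of the third tensor product lifts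
  -- to one of the second. An element dying in the quotient can thus be corrected by a relation to
  -- die before passing to quotients, where exactness is `h`.
  have hrel : tensorRel G'' F'' n ≤ (tensorRel G' F' n).map (tensorPreMap α' β' n) := by
    refine Submodule.span_le.2 ?_
    rintro _ ⟨X, Y, f, i, j, hf, g, x, rfl⟩
    obtain ⟨g, rfl⟩ := surjective_of_epi α' _ i g
    obtain ⟨x, rfl⟩ := surjective_of_epi β' Y _ x
    refine ⟨_, Submodule.subset_span ⟨X, Y, f, i, j, hf, g, x, rfl⟩, ?_⟩
    rw [_root_.map_sub, tensorPreMap, DirectSum.lmap_lof, DirectSum.lmap_lof]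
    simp only [TensorProduct.map_tmul, α'.naturality, β'.naturality]
  intro z
  constructor
  · intro hz
    obtain ⟨z, rfl⟩ := Submodule.mkQ_surjective _ z
    have hz' : tensorPreMap α' β' n z ∈ tensorRel G'' F'' n :=
      (Submodule.Quotient.mk_eq_zero _).1 hz
    obtain ⟨r, hr, hrz⟩ := hrel hz'
    have : z - r ∈ LinearMap.range (tensorPreMap α β n) := by
      rw [← hpre, LinearMap.mem_ker, _root_.map_sub, hrz, sub_self]
    obtain ⟨y, hy⟩ := this
    refine ⟨(tensorRel G F n).mkQ y, ?_⟩
    change (tensorRel G' F' n).mkQ (tensorPreMap α β n y) = _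
    rw [hy, _root_.map_sub, sub_eq_self]
    exact (Submodule.Quotient.mk_eq_zero _).2 hr
  · rintro ⟨y, rfl⟩
    obtain ⟨y, rfl⟩ := Submodule.mkQ_surjective _ y
    change (tensorRel G'' F'' n).mkQ (tensorPreMap α' β' n (tensorPreMap α β n y)) = 0
    have : tensorPreMap α β n y ∈ LinearMap.ker (tensorPreMap α' β' n) := by
      rw [hpre]; exact ⟨y, rfl⟩
    rw [LinearMap.mem_ker.1 this, _root_.map_zero]

/-- Right exactness of the tensor product in the second variable. -/
lemma tensorMap_exact_right (G : GrFunctor.{w} K Cᵒᵖ) {F F' F'' : GrFunctor.{w} K C}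
    (β : F ⟶ F') (β' : F' ⟶ F'') [Epi β'] (n : ℤ)
    (h : ∀ Y i, Function.Exact (β.app Y i) (β'.app Y i)) :
    Function.Exact (tensorMap (𝟙 G) β n) (tensorMap (𝟙 G) β' n) :=
  tensorMap_exact _ _ _ _ n fun Y i ↦
    lTensor_exact (G.obj (Opposite.op Y) i) (h Y (n - i)) (surjective_of_epi β' Y _)

/-- Right exactness of the tensor product in the first variable. -/
lemma tensorMap_exact_left {G G' G'' : GrFunctor.{w} K Cᵒᵖ} (F : GrFunctor.{w} K C)
    (α : G ⟶ G') (α' : G' ⟶ G'') [Epi α'] (n : ℤ)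
    (h : ∀ Y i, Function.Exact (α.app Y i) (α'.app Y i)) :
    Function.Exact (tensorMap α (𝟙 F) n) (tensorMap α' (𝟙 F) n) :=
  tensorMap_exact _ _ _ _ n fun Y i ↦
    rTensor_exact (F.obj Y (n - i)) (h _ i) (surjective_of_epi α' _ _)

lemma kernelι_exact {F F' : GrFunctor.{w} K C} (β : F ⟶ F') (Y : C) (i : ℤ) :
    Function.Exact ((kernelι β).app Y i) (β.app Y i) := fun x ↦
  ⟨fun h ↦ ⟨⟨x, h⟩, rfl⟩, by rintro ⟨y, rfl⟩; exact y.2⟩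

lemma cokernelπ_exact {F F' : GrFunctor.{w} K C} (β : F ⟶ F') (Y : C) (i : ℤ) :
    Function.Exact (β.app Y i) ((cokernelπ β).app Y i) := fun _ ↦
  ⟨fun h ↦ (Submodule.Quotient.mk_eq_zero _).1 h, fun h ↦ (Submodule.Quotient.mk_eq_zero _).2 h⟩

instance {F F' : GrFunctor.{w} K C} (β : F ⟶ F') : Epi (cokernelπ β) :=
  epi_of_surjective _ fun _ _ ↦ Submodule.mkQ_surjective _

lemma mono_of_injective {F F' : GrFunctor.{w} K C} (β : F ⟶ F')
    (h : ∀ X i, Function.Injective (β.app X i)) : Mono β where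
  right_cancellation γ δ e := by
    ext X i y
    exact h X i (congrArg (fun ε : _ ⟶ F' ↦ ε.app X i y) e)

instance {F F' : GrFunctor.{w} K C} (β : F ⟶ F') : Mono (kernelι β) :=
  mono_of_injective _ fun _ _ ↦ Subtype.val_injective

end GrFunctor

/-! ### Projective graded functors are flat -/

namespace GrFunctor

variable {K : Type k} [Field K] {C : Type u} [Category.{v} C] [Preadditive C] [Linear K C]
  [GradedCategory K C]

open Classical in
/-- The projection of a direct sum onto a summand. -/
noncomputable def sumπ {ι : Type w} (F : ι → GrFunctor.{w} K C) (a : ι) : sumFunctor F ⟶ F a where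
  app X i := DirectSum.component K ι (fun a ↦ (F a).obj X i) a
  naturality _ _ _ _ _ := rfl

open Classical in
-- The identity is asserted for every finite set containing the support, so that the supports of two
-- tensors can be united in `tensorLeft_sum` and `tensorRight_sum`.
lemma exists_sum_component {ι : Type w} (F : ι → GrFunctor.{w} K C) (X : C) (i : ℤ)
    (x : (sumFunctor F).obj X i) :
    ∃ s : Finset ι, ∀ t, s ⊆ t → ∑ a ∈ t, (sumπ F a ≫ sumι F a).app X i x = x := by
  let x' : ⨁ a, (F a).obj X i := x
  refine ⟨DFinsupp.support x', fun t ht ↦ ?_⟩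
  change ∑ a ∈ t, DirectSum.lof K ι (fun a ↦ (F a).obj X i) a (x' a) = x'
  refine DFinsupp.ext fun b ↦ ?_
  rw [DFinsupp.finsetSum_apply]
  by_cases hb : b ∈ t
  · rw [Finset.sum_eq_single_of_mem b hb fun a _ hab ↦ ?_]
    · exact DirectSum.of_eq_same (β := fun a ↦ (F a).obj X i) b (x' b)
    · exact DirectSum.of_eq_of_ne (β := fun a ↦ (F a).obj X i) a b (x' a) hab.symm
  · have h0 : x' b = 0 := DFinsupp.notMem_support_iff.1 fun h ↦ hb (ht h)
    rw [h0]
    exact Finset.sum_eq_zero fun a ha ↦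
      DirectSum.of_eq_of_ne (β := fun a ↦ (F a).obj X i) a b (x' a) (fun h ↦ hb (h.symm ▸ ha))

/-- The explicit form of the cover matters: a projective functor is a retract of a sum of shifted
representables, so flatness has to be checked only on those. -/
lemma exists_sum_rep_epi [EssentiallySmall.{w} C] (F : GrFunctor.{w} K C) :
    ∃ (ι : Type w) (X : ι → C) (m : ι → ℤ)
      (π : sumFunctor (fun a ↦ repFunctor.{w} (K := K) (X a) (m a)) ⟶ F), Epi π := by
  let obj : SmallModel.{w} C → C := (equivSmallModel.{w} C).inverse.obj
  let ι := Σ (s : SmallModel.{w} C) (i : ℤ), F.obj (obj s) i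
  let P : ι → GrFunctor.{w} K C := fun a ↦ repFunctor (obj a.1) a.2.1
  let π : sumFunctor P ⟶ F := sumDesc fun a ↦ repHom F (obj a.1) a.2.1 a.2.2
  refine ⟨ι, fun a ↦ obj a.1, fun a ↦ a.2.1, π, epi_of_surjective π fun Y ↦ ?_⟩
  refine surjective_of_iso π ((equivSmallModel.{w} C).unitIso.app Y) fun i x ↦ ?_
  let a : ι := ⟨(equivSmallModel.{w} C).functor.obj Y, i, x⟩
  refine ⟨(sumι P a).app _ i (repGen _ i), ?_⟩
  rw [← comp_app]
  exact (congrArg (fun δ : P a ⟶ F ↦ δ.app _ i (repGen _ i)) (sumι_desc _ a)).trans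
    (repHom_gen F _ i x)

/-- A natural transformation between functors that commute with direct sums is injective on
projective objects if it is injective on shifted representable functors. -/
lemma injective_of_projective [EssentiallySmall.{w} C] {T T' : GrFunctor.{w} K C ⥤ ModuleCat.{x} K}
    (τ : T ⟶ T')
    (hsum : ∀ {ι : Type w} (P : ι → GrFunctor.{w} K C) (z : T.obj (sumFunctor P)),
      ∃ s : Finset ι, ∑ a ∈ s, (T.map (sumπ P a ≫ sumι P a)).hom z = z)
    (hrep : ∀ X m, Function.Injective (τ.app (repFunctor X m)).hom)
    (P : GrFunctor.{w} K C) [Projective P] : Function.Injective (τ.app P).hom := by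
  have key : ∀ {A B : GrFunctor.{w} K C} (f : A ⟶ B) (z : T.obj A), (τ.app A).hom z = 0 →
      (τ.app B).hom ((T.map f).hom z) = 0 := fun f z hz ↦ by
    have := LinearMap.congr_fun (congrArg ModuleCat.Hom.hom (τ.naturality f)) z
    simp only [ModuleCat.hom_comp, LinearMap.comp_apply] at this
    rw [this, hz, _root_.map_zero]
  -- With `P` a retract of a sum of representables, an element of the kernel is sent into that sum
  -- by `σ`, where each component vanishes by `hrep` and finitely many components recover it; `π`
  -- then brings it back.
  obtain ⟨ι, X, m, π, hπ⟩ := exists_sum_rep_epi P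
  let σ := Projective.factorThru (𝟙 P) π
  have hσ : σ ≫ π = 𝟙 P := Projective.factorThru_comp _ _
  rw [← LinearMap.ker_eq_bot, Submodule.eq_bot_iff]
  intro z hz
  have h0 : (T.map σ).hom z = 0 := by
    obtain ⟨s, hs⟩ := hsum _ ((T.map σ).hom z)
    rw [← hs]
    refine Finset.sum_eq_zero fun a _ ↦ ?_
    have h1 := key (sumπ _ a) _ (key σ z hz)
    have h2 := hrep _ _ (h1.trans (_root_.map_zero _).symm)
    rw [T.map_comp, ModuleCat.hom_comp, LinearMap.comp_apply, h2, _root_.map_zero]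
  have h3 : (T.map π).hom ((T.map σ).hom z) = z := by
    rw [← LinearMap.comp_apply, ← ModuleCat.hom_comp, ← T.map_comp, hσ, T.map_id]
    rfl
  rw [← h3, h0, _root_.map_zero]

/-- The degree `n` part of the functor `- ⊗_C F`. -/
noncomputable def tensorRight (F : GrFunctor.{w} K C) (n : ℤ) :
    GrFunctor.{w} K Cᵒᵖ ⥤ ModuleCat.{max u w} K where
  obj G := ModuleCat.of K (TensorDeg G F n)
  map α := ModuleCat.ofHom (tensorMap α (𝟙 F) n)
  map_id G := ModuleCat.hom_ext (tensorMap_id G F n)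
  map_comp α α' := ModuleCat.hom_ext (by
    rw [ModuleCat.hom_comp, ModuleCat.hom_ofHom, ModuleCat.hom_ofHom, ModuleCat.hom_ofHom,
      ← tensorMap_comp, Category.comp_id])

/-- The natural transformation `α ⊗ -`. -/
noncomputable def tensorLeftMap {G G' : GrFunctor.{w} K Cᵒᵖ} (α : G ⟶ G') (n : ℤ) :
    tensorLeft.{w} G n ⟶ tensorLeft G' n where
  app F := ModuleCat.ofHom (tensorMap α (𝟙 F) n)
  naturality F F' β := ModuleCat.hom_ext <| by
    change tensorMap α (𝟙 F') n ∘ₗ tensorMap (𝟙 G) β n = tensorMap (𝟙 G') β n ∘ₗ tensorMap α (𝟙 F) n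
    simp only [← tensorMap_comp, Category.comp_id, Category.id_comp]

/-- The natural transformation `- ⊗ β`. -/
noncomputable def tensorRightMap {F F' : GrFunctor.{w} K C} (β : F ⟶ F') (n : ℤ) :
    tensorRight.{w} F n ⟶ tensorRight F' n where
  app G := ModuleCat.ofHom (tensorMap (𝟙 G) β n)
  naturality G G' α := ModuleCat.hom_ext <| by
    change tensorMap (𝟙 G') β n ∘ₗ tensorMap α (𝟙 F) n = tensorMap α (𝟙 F') n ∘ₗ tensorMap (𝟙 G) β n
    simp only [← tensorMap_comp, Category.comp_id, Category.id_comp]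

open Classical in
lemma tensorLeft_sum (G : GrFunctor.{w} K Cᵒᵖ) (n : ℤ) {ι : Type w} (P : ι → GrFunctor.{w} K C)
    (z : TensorDeg G (sumFunctor P) n) :
    ∃ s : Finset ι, ∑ a ∈ s, tensorMap (𝟙 G) (sumπ P a ≫ sumι P a) n z = z := by
  suffices h : ∃ s : Finset ι, ∀ t, s ⊆ t →
      ∑ a ∈ t, tensorMap (𝟙 G) (sumπ P a ≫ sumι P a) n z = z by
    obtain ⟨s, hs⟩ := h
    exact ⟨s, hs s le_rfl⟩
  induction z using tensor_induction with
  | zero => exact ⟨∅, fun t _ ↦ by simp⟩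
  | add z z' h h' =>
    obtain ⟨s, hs⟩ := h
    obtain ⟨s', hs'⟩ := h'
    refine ⟨s ∪ s', fun t ht ↦ ?_⟩
    simp_rw [_root_.map_add, Finset.sum_add_distrib]
    rw [hs t (Finset.union_subset_left ht), hs' t (Finset.union_subset_right ht)]
  | h Y i g x =>
    obtain ⟨s, hs⟩ := exists_sum_component P Y (n - i) x
    refine ⟨s, fun t ht ↦ ?_⟩
    simp_rw [tensorMap_tmul, id_app]
    rw [← _root_.map_sum, hs t ht]

open Classical in
lemma tensorRight_sum (F : GrFunctor.{w} K C) (n : ℤ) {ι : Type w} (P : ι → GrFunctor.{w} K Cᵒᵖ)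
    (z : TensorDeg (sumFunctor P) F n) :
    ∃ s : Finset ι, ∑ a ∈ s, tensorMap (sumπ P a ≫ sumι P a) (𝟙 F) n z = z := by
  suffices h : ∃ s : Finset ι, ∀ t, s ⊆ t →
      ∑ a ∈ t, tensorMap (sumπ P a ≫ sumι P a) (𝟙 F) n z = z by
    obtain ⟨s, hs⟩ := h
    exact ⟨s, hs s le_rfl⟩
  induction z using tensor_induction with
  | zero => exact ⟨∅, fun t _ ↦ by simp⟩
  | add z z' h h' =>
    obtain ⟨s, hs⟩ := h
    obtain ⟨s', hs'⟩ := h'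
    refine ⟨s ∪ s', fun t ht ↦ ?_⟩
    simp_rw [_root_.map_add, Finset.sum_add_distrib]
    rw [hs t (Finset.union_subset_left ht), hs' t (Finset.union_subset_right ht)]
  | h Y i g x =>
    obtain ⟨s, hs⟩ := exists_sum_component P (Opposite.op Y) i g
    refine ⟨s, fun t ht ↦ ?_⟩
    simp_rw [tensorMap_tmul, id_app]
    rw [← LinearMap.sum_apply, ← _root_.map_sum, hs t ht]

/-! ### Tensor products with representable functors: the co-Yoneda isomorphisms -/

section Representable

variable [LocallySmall.{w} C]

/-- The universal element of a shifted representable functor, in a degree equal to the shift. -/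
noncomputable def repGenOfEq (X : C) {m j : ℤ} (h : j = m) :
    (repFunctor.{w} (K := K) X m).obj X j :=
  (repEquiv X m X j).symm ⟨𝟙 X, homDeg_congr (by omega) (homDeg_id X m)⟩

/-- Yoneda: an element of a representable is its own action on the universal element. The degree `l`
is separated from the shift `m` because tensor degrees such as n - (n - m) equal `m` only
propositionally. -/
lemma rep_map_gen (X : C) {m l : ℤ} (h : l = m) {Y : C} {i : ℤ}
    (y : (repFunctor.{w} (K := K) X m).obj Y i) :
    (repFunctor X m).map (repEquiv X m Y i y).1 l i
      (homDeg_congr (by omega) (repEquiv X m Y i y).2) (repGenOfEq X h) = y := by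
  apply (repEquiv X m Y i).injective
  rw [repEquiv_map, repGenOfEq, LinearEquiv.apply_symm_apply]
  exact Subtype.ext (Category.comp_id _)

/-- The action `G(Y)_i ⊗ Hom(Y, X)_{n - i - m} → G(X)_{n - m}`. -/
noncomputable def repActLeft (G : GrFunctor.{w} K Cᵒᵖ) (X : C) (m n : ℤ) (Y : C) (i : ℤ) :
    G.obj (Opposite.op Y) i →ₗ[K] (repFunctor.{w} (K := K) X m).obj Y (n - i) →ₗ[K]
      G.obj (Opposite.op X) (n - m) :=
  LinearMap.mk₂ K (fun g y ↦ G.map (repEquiv X m Y (n - i) y).1.op i (n - m)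
      (homDeg_congr (by omega) (homDeg_op (repEquiv X m Y (n - i) y).2)) g)
    (fun g g' y ↦ _root_.map_add _ _ _) (fun c g y ↦ _root_.map_smul _ _ _)
    (fun g y y' ↦ LinearMap.congr_fun
      ((G.map_congr (by rw [_root_.map_add]; rfl) _ _).trans (G.map_add _ _ _ _ _ _)) g)
    (fun c g y ↦ LinearMap.congr_fun
      ((G.map_congr (by rw [_root_.map_smul]; rfl) _ _).trans (G.map_smul c _ _ _ _)) g)

lemma repActLeft_balanced (G : GrFunctor.{w} K Cᵒᵖ) (X : C) (m n : ℤ) {Y Z : C} (f : Y ⟶ Z)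
    (i j : ℤ) (hf : f ∈ homDeg K Y Z (j - i)) (g : G.obj (Opposite.op Y) i)
    (y : (repFunctor.{w} (K := K) X m).obj Z (n - j)) :
    repActLeft G X m n Z j (G.map f.op i j (homDeg_op hf) g) y =
      repActLeft G X m n Y i g
        ((repFunctor X m).map f (n - j) (n - i) (homDeg_congr (by omega) hf) y) := by
  have h := LinearMap.congr_fun (G.map_comp (repEquiv X m Z (n - j) y).1.op f.op i j (n - m)
    (homDeg_congr (by omega) (homDeg_op (repEquiv X m Z (n - j) y).2)) (homDeg_op hf)) g
  refine h.symm.trans (LinearMap.congr_fun (G.map_congr ?_ _ _) g)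
  rw [repEquiv_map]
  rfl

/-- The morphism `G ⊗ Hom(-, X)[-m] → G(X)[-m]`. -/
noncomputable def tensorRepLeft (G : GrFunctor.{w} K Cᵒᵖ) (X : C) (m n : ℤ) :
    TensorDeg G (repFunctor.{w} (K := K) X m) n →ₗ[K] G.obj (Opposite.op X) (n - m) :=
  tensorLift (repActLeft G X m n) (repActLeft_balanced G X m n)

lemma tensorRepLeft_tmul (G : GrFunctor.{w} K Cᵒᵖ) (X : C) (m n : ℤ) (Y : C) (i : ℤ)
    (g : G.obj (Opposite.op Y) i) (y : (repFunctor.{w} (K := K) X m).obj Y (n - i)) :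
    tensorRepLeft G X m n (tmul G _ n Y i g y) = repActLeft G X m n Y i g y :=
  tensorLift_tmul _ (repActLeft_balanced G X m n) _ _ _ _

/-- Moving morphisms across the tensor sign brings every element to the form g ⊗ 𝟙 X, and
`tensorRepLeft` recovers `g`. So the map is `α` at `X` in degree n - m, which is injective. -/
lemma tensorMap_rep_injective_left {G G' : GrFunctor.{w} K Cᵒᵖ} (α : G ⟶ G') [Mono α] (X : C)
    (m n : ℤ) :
    Function.Injective (tensorMap α (𝟙 (repFunctor.{w} (K := K) X m)) n) := by
  have hgen : ∀ z : TensorDeg G (repFunctor.{w} (K := K) X m) n, ∃ g,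
      z = tmul G _ n X (n - m) g (repGenOfEq X (by omega)) := fun z ↦ by
    induction z using tensor_induction with
    | zero => exact ⟨0, by simp⟩
    | add z z' h h' =>
      obtain ⟨g, rfl⟩ := h
      obtain ⟨g', rfl⟩ := h'
      exact ⟨g + g', by simp⟩
    | h Y i g y =>
      refine ⟨G.map (repEquiv X m Y (n - i) y).1.op i (n - m)
        (homDeg_congr (by omega) (homDeg_op (repEquiv X m Y (n - i) y).2)) g, ?_⟩
      rw [tmul_map _ i (n - m) (homDeg_congr (by omega) (repEquiv X m Y (n - i) y).2),
        rep_map_gen]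
  rw [← LinearMap.ker_eq_bot, Submodule.eq_bot_iff]
  intro z hz
  obtain ⟨g, rfl⟩ := hgen z
  rw [LinearMap.mem_ker, tensorMap_tmul, id_app] at hz
  have h := congrArg (tensorRepLeft G' X m n) hz
  rw [_root_.map_zero, tensorRepLeft_tmul] at h
  have h1 : α.app _ _ g = 0 := by
    refine Eq.trans ?_ h
    refine (LinearMap.congr_fun (G'.map_id _ _) _).symm.trans
      (LinearMap.congr_fun (G'.map_congr ?_ _ _) _)
    rw [repGenOfEq, LinearEquiv.apply_symm_apply]
    rfl
  rw [injective_of_mono α _ _ (h1.trans (_root_.map_zero _).symm), _root_.map_zero,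
    LinearMap.zero_apply]

/-- The action `Hom(Z, Y)_{i - m} ⊗ F(Y)_{n - i} → F(Z)_{n - m}`. -/
noncomputable def repActRight (F : GrFunctor.{w} K C) (Z : C) (m n : ℤ) (Y : C) (i : ℤ) :
    (repFunctor.{w} (K := K) (Opposite.op Z) m).obj (Opposite.op Y) i →ₗ[K]
      F.obj Y (n - i) →ₗ[K] F.obj Z (n - m) :=
  LinearMap.mk₂ K (fun s x ↦ F.map (repEquiv (Opposite.op Z) m (Opposite.op Y) i s).1.unop
      (n - i) (n - m)
      (homDeg_congr (by omega) (repEquiv (Opposite.op Z) m (Opposite.op Y) i s).2) x)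
    (fun s s' x ↦ LinearMap.congr_fun
      ((F.map_congr (by rw [_root_.map_add]; rfl) _ _).trans (F.map_add _ _ _ _ _ _)) x)
    (fun c s x ↦ LinearMap.congr_fun
      ((F.map_congr (by rw [_root_.map_smul]; rfl) _ _).trans (F.map_smul c _ _ _ _)) x)
    (fun s x x' ↦ _root_.map_add _ _ _) (fun c s x ↦ _root_.map_smul _ _ _)

lemma repActRight_balanced (F : GrFunctor.{w} K C) (Z : C) (m n : ℤ) {X Y : C} (f : X ⟶ Y)
    (i j : ℤ) (hf : f ∈ homDeg K X Y (j - i))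
    (s : (repFunctor.{w} (K := K) (Opposite.op Z) m).obj (Opposite.op X) i)
    (x : F.obj Y (n - j)) :
    repActRight F Z m n Y j ((repFunctor (Opposite.op Z) m).map f.op i j (homDeg_op hf) s) x =
      repActRight F Z m n X i s (F.map f (n - j) (n - i) (homDeg_congr (by omega) hf) x) := by
  have h := LinearMap.congr_fun (F.map_comp
    (repEquiv (Opposite.op Z) m (Opposite.op X) i s).1.unop f (n - j) (n - i) (n - m)
    (homDeg_congr (by omega) (repEquiv (Opposite.op Z) m (Opposite.op X) i s).2)
    (homDeg_congr (by omega) hf)) x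
  refine Eq.trans (LinearMap.congr_fun (F.map_congr ?_ _ _) x) h
  rw [repEquiv_map]
  rfl

/-- The morphism `Hom(Z, -)[-m] ⊗ F → F(Z)[-m]`. -/
noncomputable def tensorRepRight (F : GrFunctor.{w} K C) (Z : C) (m n : ℤ) :
    TensorDeg (repFunctor.{w} (K := K) (Opposite.op Z) m) F n →ₗ[K] F.obj Z (n - m) :=
  tensorLift (repActRight F Z m n) (repActRight_balanced F Z m n)

lemma tensorRepRight_tmul (F : GrFunctor.{w} K C) (Z : C) (m n : ℤ) (Y : C) (i : ℤ)
    (s : (repFunctor.{w} (K := K) (Opposite.op Z) m).obj (Opposite.op Y) i) (x : F.obj Y (n - i)) :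
    tensorRepRight F Z m n (tmul _ F n Y i s x) = repActRight F Z m n Y i s x :=
  tensorLift_tmul _ (repActRight_balanced F Z m n) _ _ _ _

lemma exists_tmul_repGen (F : GrFunctor.{w} K C) (Z : C) (m n : ℤ)
    (z : TensorDeg (repFunctor.{w} (K := K) (Opposite.op Z) m) F n) :
    ∃ x, z = tmul _ F n Z m (repGenOfEq (Opposite.op Z) rfl) x := by
  induction z using tensor_induction with
  | zero => exact ⟨0, by simp⟩
  | add z z' h h' =>
    obtain ⟨g, rfl⟩ := h
    obtain ⟨g', rfl⟩ := h'
    exact ⟨g + g', by simp⟩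
  | h Y i s x =>
    refine ⟨F.map (repEquiv (Opposite.op Z) m (Opposite.op Y) i s).1.unop (n - i) (n - m)
      (homDeg_congr (by omega) (repEquiv (Opposite.op Z) m (Opposite.op Y) i s).2) x, ?_⟩
    rw [← tmul_map (G := repFunctor.{w} (K := K) (Opposite.op Z) m)
      (repEquiv (Opposite.op Z) m (Opposite.op Y) i s).1.unop m i
      (repEquiv (Opposite.op Z) m (Opposite.op Y) i s).2]
    congr 2
    exact (rep_map_gen (Opposite.op Z) rfl s).symm

lemma tensorRepRight_gen (F : GrFunctor.{w} K C) (Z : C) (m n : ℤ) (x : F.obj Z (n - m)) :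
    tensorRepRight F Z m n (tmul _ F n Z m (repGenOfEq (Opposite.op Z) rfl) x) = x := by
  rw [tensorRepRight_tmul]
  refine Eq.trans (LinearMap.congr_fun (F.map_congr ?_ _ _) _)
    (LinearMap.congr_fun (F.map_id _ _) _)
  rw [repGenOfEq, LinearEquiv.apply_symm_apply]
  rfl

lemma tensorMap_rep_injective_right {F F' : GrFunctor.{w} K C} (β : F ⟶ F') [Mono β] (Z : C)
    (m n : ℤ) :
    Function.Injective
      (tensorMap (𝟙 (repFunctor.{w} (K := K) (Opposite.op Z) m)) β n) := by
  rw [← LinearMap.ker_eq_bot, Submodule.eq_bot_iff]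
  intro z hz
  obtain ⟨x, rfl⟩ := exists_tmul_repGen F Z m n z
  rw [LinearMap.mem_ker, tensorMap_tmul, id_app] at hz
  have h := congrArg (tensorRepRight F' Z m n) hz
  rw [_root_.map_zero, tensorRepRight_gen] at h
  rw [injective_of_mono β _ _ (h.trans (_root_.map_zero _).symm), _root_.map_zero]

end Representable

variable [EssentiallySmall.{w} C]

lemma tensorMap_injective_left {G G' : GrFunctor.{w} K Cᵒᵖ} (α : G ⟶ G') [Mono α]
    (P : GrFunctor.{w} K C) [Projective P] (n : ℤ) :
    Function.Injective (tensorMap α (𝟙 P) n) :=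
  injective_of_projective (tensorLeftMap α n) (fun P z ↦ tensorLeft_sum G n P z)
    (fun X m ↦ tensorMap_rep_injective_left α X m n) P

lemma tensorMap_injective_right {F F' : GrFunctor.{w} K C} (β : F ⟶ F') [Mono β]
    (Q : GrFunctor.{w} K Cᵒᵖ) [Projective Q] (n : ℤ) :
    Function.Injective (tensorMap (𝟙 Q) β n) :=
  injective_of_projective (tensorRightMap β n) (fun P z ↦ tensorRight_sum F n P z)
    (fun X m ↦ tensorMap_rep_injective_right β X.unop m n) Q

end GrFunctor

/-! ### Syzygies, `Tor` and flatness -/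

namespace GrFunctor

variable {K : Type k} [Field K] {C : Type u} [Category.{v} C] [Preadditive C] [Linear K C]
  [GradedCategory K C]

lemma kernel_shortExact {P F : GrFunctor.{w} K C} (ρ : P ⟶ F) [Epi ρ] :
    (ShortComplex.mk (kernelι ρ) ρ (kernelι_comp ρ)).ShortExact where
  exact := ShortComplex.exact_of_f_is_kernel _ (kernelIsLimit ρ)

variable [EssentiallySmall.{w} C]

/-- For short exact sequences `0 → G' → Q → G → 0` with `Q` projective and `0 → F' → P → F → 0`,
injectivity of `G' ⊗ F → Q ⊗ F` implies injectivity of `G ⊗ F' → G ⊗ P`. -/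
lemma tensorMap_kernelι_injective {Q G : GrFunctor.{w} K Cᵒᵖ} (π : Q ⟶ G) [Epi π] [Projective Q]
    {P F : GrFunctor.{w} K C} (ρ : P ⟶ F) [Epi ρ] (n : ℤ)
    (h : Function.Injective (tensorMap (kernelι π) (𝟙 F) n)) :
    Function.Injective (tensorMap (𝟙 G) (kernelι ρ) n) := by
  rw [← LinearMap.ker_eq_bot, Submodule.eq_bot_iff]
  intro z hz
  rw [LinearMap.mem_ker] at hz
  -- Diagram chase with G' = ker π and F' = ker ρ. Lift `z` to `y` in Q ⊗ F'; its image in Q ⊗ P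
  -- dies in G ⊗ P, so it comes from `x` in G' ⊗ P. By `h`, `x` dies in G' ⊗ F, so it comes from `v`
  -- in G' ⊗ F'. As the projective `Q` is flat, `v` maps to `y`, which therefore dies in G ⊗ F'.
  obtain ⟨y, rfl⟩ := tensorMap_surjective π (𝟙 (kernelFunctor ρ)) n z
  have hy : tensorMap π (𝟙 P) n (tensorMap (𝟙 Q) (kernelι ρ) n y) = 0 := by
    rw [tensorMap_comp_apply] at hz ⊢
    simpa only [Category.id_comp, Category.comp_id] using hz
  obtain ⟨x, hx⟩ := (tensorMap_exact_left P (kernelι π) π n (kernelι_exact π) _).1 hy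
  have hx0 : tensorMap (𝟙 _) ρ n x = 0 := by
    apply h
    rw [_root_.map_zero, tensorMap_comp_apply, Category.id_comp, Category.comp_id,
      ← Category.comp_id (kernelι π), ← Category.id_comp ρ, ← tensorMap_comp_apply, hx]
    exact (tensorMap_exact_right Q (kernelι ρ) ρ n (kernelι_exact ρ)).apply_apply_eq_zero y
  obtain ⟨v, rfl⟩ := (tensorMap_exact_right _ (kernelι ρ) ρ n (kernelι_exact ρ) _).1 hx0
  have hv : tensorMap (kernelι π) (𝟙 _) n v = y := by
    apply tensorMap_injective_right (kernelι ρ) Q n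
    rw [← hx, tensorMap_comp_apply, tensorMap_comp_apply]
    simp only [Category.id_comp, Category.comp_id]
  rw [← hv]
  exact (tensorMap_exact_left _ (kernelι π) π n (kernelι_exact π)).apply_apply_eq_zero v

omit [EssentiallySmall.{w} C] in
/-- The functor `G ⊗ -` preserves the kernels of all projective presentations of the `m`-th
syzygies of `F`. -/
def SyzygyInjective : ℕ → GrFunctor.{w} K Cᵒᵖ → GrFunctor.{w} K C → Prop
  | 0, G, F => ∀ (P : GrFunctor.{w} K C) (ρ : P ⟶ F) [Epi ρ] [Projective P] (n : ℤ),
      Function.Injective (tensorMap (𝟙 G) (kernelι ρ) n)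
  | m + 1, G, F => ∀ (P : GrFunctor.{w} K C) (ρ : P ⟶ F) [Epi ρ] [Projective P],
      SyzygyInjective m G (kernelFunctor ρ)

/-- Dimension shifting in the first variable. In the base case G' ⊗ ker ρ₀ → G' ⊗ P₀ → Q ⊗ P₀, with
G' = ker π, is injective by `h` and flatness of P₀. It factors through Q ⊗ ker ρ₀, so the first
factor G' ⊗ ker ρ₀ → Q ⊗ ker ρ₀ is injective, which is what the chase needs. -/
lemma SyzygyInjective.succ {Q G : GrFunctor.{w} K Cᵒᵖ} (π : Q ⟶ G) [Epi π] [Projective Q]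
    (m : ℕ) (F : GrFunctor.{w} K C) (h : SyzygyInjective m (kernelFunctor π) F) :
    SyzygyInjective (m + 1) G F := by
  induction m generalizing F with
  | zero =>
    intro P₀ ρ₀ _ _ P₁ ρ₁ _ _ n
    refine tensorMap_kernelι_injective π ρ₁ n ?_
    have h₁ := (tensorMap_injective_left (kernelι π) P₀ n).comp (h P₀ ρ₀ n)
    rw [← LinearMap.coe_comp, ← tensorMap_comp, Category.id_comp, Category.comp_id,
      ← Category.comp_id (kernelι π), ← Category.id_comp (kernelι ρ₀), tensorMap_comp,
      LinearMap.coe_comp] at h₁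
    exact h₁.of_comp
  | succ m ih =>
    intro P ρ _ _
    exact ih _ (h P ρ)

/-- Each step replaces `G` by the kernel of a projective presentation, lowering its projective
dimension by one, until `G` itself is projective and hence flat. -/
lemma syzygyInjective_of_hasProjectiveDimensionLE (m : ℕ) (G : GrFunctor.{w} K Cᵒᵖ)
    [hG : HasProjectiveDimensionLE G m] (F : GrFunctor.{w} K C) : SyzygyInjective m G F := by
  induction m generalizing G with
  | zero =>
    have : Projective G := (projective_iff_hasProjectiveDimensionLE_zero G).2 hG
    intro P ρ _ _ n
    exact tensorMap_injective_right (kernelι ρ) G n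
  | succ m ih =>
    have hQ : HasProjectiveDimensionLT (Projective.over G) (m + 1) :=
      hasProjectiveDimensionLT_of_ge _ 1 _ (by omega)
    have : HasProjectiveDimensionLE (kernelFunctor (Projective.π G)) m :=
      (kernel_shortExact (Projective.π G)).hasProjectiveDimensionLT_X₁ (m + 1) hQ hG
    exact SyzygyInjective.succ (Projective.π G) m F (ih _)

/-- Flatness supplies the hypothesis of the diagram chase for any projective presentation of `G`. -/
lemma IsFlat.syzygyInjective {F : GrFunctor.{w} K C} (hF : F.IsFlat) (G : GrFunctor.{w} K Cᵒᵖ) :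
    SyzygyInjective 0 G F := fun _ ρ _ _ n ↦
  tensorMap_kernelι_injective (Projective.π G) ρ n (hF _ _ (kernelι (Projective.π G)) n)

/-- If `Tor_1(G, F) = 0`, then `G ⊗ -` preserves the kernel of the augmentation of
any projective resolution of `F`. -/
lemma TorIsZero.injective {G : GrFunctor.{w} K Cᵒᵖ} {F : GrFunctor.{w} K C} (h : TorIsZero 1 G F)
    (R : ProjectiveResolution F) (n : ℤ) :
    Function.Injective (tensorMap (𝟙 G) (kernelι (R.π.f 0)) n) := by
  let T := tensorLeft.{w} G n
  let d₁ : R.complex.X 1 ⟶ kernelFunctor (R.π.f 0) :=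
    kernelLift _ (R.complex.d 1 0) R.complex_d_comp_π_f_zero
  have hd₁ : d₁ ≫ kernelι (R.π.f 0) = R.complex.d 1 0 := rfl
  have hd₂ : R.complex.d 2 1 ≫ d₁ = 0 := by
    rw [← cancel_mono (kernelι (R.π.f 0)), Category.assoc, hd₁, R.complex.d_comp_d, zero_comp]
  -- An element of the kernel is a morphism from a representable; the latter is projective, so
  -- exactness of the resolution lifts it to degree one.
  have hepi : Epi d₁ := by
    refine epi_of_surjective _ fun X i ⟨x, hx⟩ ↦ ?_
    have h0 : repHom _ X i x ≫ R.π.f 0 = 0 := repHom_ext (by rw [comp_app, repHom_gen]; exact hx)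
    refine ⟨(R.exact₀.liftFromProjective (repHom _ X i x) h0).app X i (repGen X i),
      Subtype.ext ?_⟩
    have h1 := congrArg (fun δ : repFunctor X i ⟶ R.complex.X 0 ↦ δ.app X i (repGen X i))
      (R.exact₀.liftFromProjective_comp (repHom _ X i x) h0)
    exact h1.trans (repHom_gen _ _ _ _)
  have hex : (ShortComplex.mk (T.map (R.complex.d 2 1)) (T.map (R.complex.d 1 0)) (by
      rw [← T.map_comp, R.complex.d_comp_d, T.map_zero])).Exact := by
    have h0 : IsZero ((T.leftDerived 1).obj F) :=
      have : Subsingleton ((T.leftDerived 1).obj F) := h n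
      ModuleCat.isZero_of_subsingleton _
    have h1 := h0.of_iso (R.isoLeftDerivedObj T 1).symm
    have h2 : ((T.mapHomologicalComplex _).obj R.complex).ExactAt 1 :=
      (HomologicalComplex.exactAt_iff_isZero_homology _ _).2 h1
    exact (HomologicalComplex.exactAt_iff' _ 2 1 0 (by simp) (by simp)).1 h2
  rw [ShortComplex.moduleCat_exact_iff] at hex
  rw [← LinearMap.ker_eq_bot, Submodule.eq_bot_iff]
  intro z hz
  rw [LinearMap.mem_ker] at hz
  -- A lift `y` of `z` to G ⊗ X₁ is a cycle, hence a boundary by the vanishing of Tor_1; boundaries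
  -- die in G ⊗ ker because d₂ followed by `d₁` is zero.
  obtain ⟨y, rfl⟩ := tensorMap_surjective (𝟙 G) d₁ n z
  rw [tensorMap_comp_apply, Category.comp_id, hd₁] at hz
  obtain ⟨x, rfl⟩ := hex y hz
  have h0 : T.map (R.complex.d 2 1) ≫ T.map d₁ = 0 := by rw [← T.map_comp, hd₂, T.map_zero]
  exact LinearMap.congr_fun (congrArg ModuleCat.Hom.hom h0) x

end GrFunctor

/-! ### Simple functors and the radical -/

section

variable {K : Type k} [Field K] {C : Type u} [Category.{v} C] [Preadditive C] [Linear K C]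
  [GradedCategory K C]

lemma IsPositivelyGraded.op (hpos : IsPositivelyGraded K C) : IsPositivelyGraded K Cᵒᵖ :=
  fun _ _ _ hi ↦ (Submodule.eq_bot_iff _).2 fun f hf ↦
    Quiver.Hom.unop_inj (homDeg_eq_zero hpos (f := f.unop) hi hf)

end

namespace GrFunctor

variable {K : Type k} [Field K] {C : Type u} [Category.{v} C] [Preadditive C] [Linear K C]
  [GradedCategory K C]

/-- The action of the homogeneous morphisms on an element. -/
def actLin (F : GrFunctor.{w} K C) (X : C) {Y : C} {i : ℤ} (j : ℤ) (y : F.obj Y i) :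
    homDeg K X Y (j - i) →ₗ[K] F.obj X j where
  toFun f := F.map f.1 i j f.2 y
  map_add' f g := LinearMap.congr_fun (F.map_add f.1 g.1 i j f.2 g.2) y
  map_smul' c f := LinearMap.congr_fun (F.map_smul c f.1 i j f.2) y

lemma actLin_apply (F : GrFunctor.{w} K C) {X Y : C} {i j : ℤ} (y : F.obj Y i) (f : X ⟶ Y)
    (hf : f ∈ homDeg K X Y (j - i)) : actLin F X j y ⟨f, hf⟩ = F.map f i j hf y := rfl

/-- Used to reduce assertions about an arbitrary object to the local summands through which its
identity factors. -/
lemma eq_sum_map_map (F : GrFunctor.{w} K C) {X : C} {n : ℕ} {Z : Fin n → C} {q : ∀ a, X ⟶ Z a}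
    {p : ∀ a, Z a ⟶ X} (hq : ∀ a, q a ∈ homDeg K X (Z a) 0) (hp : ∀ a, p a ∈ homDeg K (Z a) X 0)
    (hsum : ∑ a, q a ≫ p a = 𝟙 X) (i : ℤ) (x : F.obj X i) :
    x = ∑ a, F.map (q a) i i (homDeg_congr (by omega) (hq a))
      (F.map (p a) i i (homDeg_congr (by omega) (hp a)) x) := by
  have h : (⟨𝟙 X, homDeg_id X i⟩ : homDeg K X X (i - i)) =
      ∑ a, ⟨q a ≫ p a, homDeg_congr (by omega) (GradedCategory.comp_mem (hq a) (hp a))⟩ :=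
    Subtype.ext (by simp [hsum])
  have h1 := congrArg (actLin F X i x) h
  rw [_root_.map_sum, actLin_apply, F.map_id] at h1
  refine h1.trans (Finset.sum_congr rfl fun a _ ↦ ?_)
  exact LinearMap.congr_fun (F.map_comp (q a) (p a) i i i _ _) x

/-- The graded subfunctor given by a stable family of subspaces. -/
def subfunctor (F : GrFunctor.{w} K C) (T : ∀ X i, Submodule K (F.obj X i))
    (hT : ∀ {X Y : C} (f : X ⟶ Y) (i j : ℤ) (hf : f ∈ homDeg K X Y (j - i)),
      ∀ y ∈ T Y i, F.map f i j hf y ∈ T X j) : GrFunctor.{w} K C where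
  obj X i := ModuleCat.of K (T X i)
  map {X Y} f i j hf := (F.map f i j hf).restrict (hT f i j hf)
  map_add f g i j hf hg := by
    exact LinearMap.ext fun x ↦ Subtype.ext (LinearMap.congr_fun (F.map_add _ _ _ _ hf hg) x.1)
  map_smul c f i j hf := by
    exact LinearMap.ext fun x ↦ Subtype.ext (LinearMap.congr_fun (F.map_smul _ _ _ _ hf) x.1)
  map_id X i := by exact LinearMap.ext fun x ↦ Subtype.ext (LinearMap.congr_fun (F.map_id X i) x.1)
  map_comp f g i j l hf hg := by
    exact LinearMap.ext fun x ↦ Subtype.ext (LinearMap.congr_fun (F.map_comp _ _ _ _ _ hf hg) x.1)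

/-- The inclusion of a graded subfunctor. -/
def subfunctorι (F : GrFunctor.{w} K C) (T : ∀ X i, Submodule K (F.obj X i))
    (hT : ∀ {X Y : C} (f : X ⟶ Y) (i j : ℤ) (hf : f ∈ homDeg K X Y (j - i)),
      ∀ y ∈ T Y i, F.map f i j hf y ∈ T X j) : subfunctor F T hT ⟶ F where
  app X i := (T X i).subtype
  naturality _ _ _ _ _ := rfl

lemma map_eq_zero (F : GrFunctor.{w} K C) {X Y : C} {f : X ⟶ Y} (h : f = 0) {i j : ℤ}
    (hf : f ∈ homDeg K X Y (j - i)) (y : F.obj Y i) : F.map f i j hf y = 0 := by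
  subst h
  exact (actLin F X j y).map_zero

/-! ### Simple tops of representables and the graded Nakayama lemma -/

section Simple

variable (hpos : IsPositivelyGraded K C)
include hpos

omit hpos in
/-- All elements in positive degrees, only zero in the other degrees. -/
def positiveSub (F : GrFunctor.{w} K C) (X : C) (i : ℤ) : Submodule K (F.obj X i) where
  carrier := {x | 0 < i ∨ x = 0}
  add_mem' := by
    rintro x y (hx | rfl) (hy | rfl)
    exacts [Or.inl hx, Or.inl hx, Or.inl hy, Or.inr (add_zero 0)]
  zero_mem' := Or.inr rfl
  smul_mem' := by
    rintro c x (hx | rfl)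
    exacts [Or.inl hx, Or.inr (smul_zero c)]

lemma map_mem_positiveSub (F : GrFunctor.{w} K C) {X Y : C} (f : X ⟶ Y) (i j : ℤ)
    (hf : f ∈ homDeg K X Y (j - i)) (y : F.obj Y i) (hy : y ∈ positiveSub F Y i) :
    F.map f i j hf y ∈ positiveSub F X j := by
  rcases lt_or_ge j i with h | h
  · rw [map_eq_zero F (homDeg_eq_zero hpos (by omega) hf)]
    exact zero_mem _
  · rcases hy with hi | rfl
    · exact Or.inl (by omega)
    · exact Or.inr (_root_.map_zero _)

/-- The part of positive degree of a graded functor over a positively graded category. -/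
def positiveFunctor (F : GrFunctor.{w} K C) : GrFunctor.{w} K C :=
  subfunctor F (positiveSub F) (map_mem_positiveSub hpos F)

/-- The inclusion of the part of positive degree. -/
def positiveι (F : GrFunctor.{w} K C) : positiveFunctor hpos F ⟶ F :=
  subfunctorι F _ _

lemma exists_positiveι_eq (F : GrFunctor.{w} K C) {X : C} {i : ℤ} (hi : 0 < i) (x : F.obj X i) :
    ∃ y, (positiveι hpos F).app X i y = x :=
  ⟨⟨x, Or.inl hi⟩, rfl⟩

lemma positiveι_eq_zero (F : GrFunctor.{w} K C) {X : C} {i : ℤ} (hi : ¬ 0 < i)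
    (y : (positiveFunctor hpos F).obj X i) : (positiveι hpos F).app X i y = 0 :=
  y.2.resolve_left hi

variable [LocallySmall.{w} C]

/-- The top `Hom(Z, -) / ∐_{i ≥ 1} Hom(Z, -)_i` of a representable functor. -/
noncomputable def topFunctor (Z : C) : GrFunctor.{w} K Cᵒᵖ :=
  cokernelFunctor (positiveι hpos.op (repFunctor.{w} (K := K) (Opposite.op Z) 0))

/-- The projection of a representable functor onto its top. -/
noncomputable def topπ (Z : C) :
    repFunctor.{w} (K := K) (Opposite.op Z) 0 ⟶ topFunctor.{w} hpos Z :=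
  cokernelπ _

instance (Z : C) : Epi (topπ.{w} hpos Z) := inferInstanceAs (Epi (cokernelπ _))

lemma topπ_exact (Z : C) (Y : Cᵒᵖ) (i : ℤ) :
    Function.Exact ((positiveι hpos.op (repFunctor.{w} (K := K) (Opposite.op Z) 0)).app Y i)
      ((topπ hpos Z).app Y i) := cokernelπ_exact _ Y i

lemma topFunctor_eq_zero (Z : C) {Y : Cᵒᵖ} {i : ℤ} (hi : 0 < i)
    (s : (topFunctor.{w} hpos Z).obj Y i) : s = 0 := by
  obtain ⟨s, rfl⟩ := surjective_of_epi (topπ.{w} hpos Z) Y i s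
  exact (topπ_exact hpos Z Y i s).2 (exists_positiveι_eq hpos.op _ hi s)

/-- A nonzero element of the top is the class of a nonzero morphism out of `Z` of degree zero. Such
a morphism has a retraction, whose action gives back the class of 𝟙 Z, a generator; so a nonzero
subobject is everything. -/
lemma simple_topFunctor
    (hrad : ∀ X Y : C, gradedRadical K X Y = (positivePart K X Y : Set (X ⟶ Y)))
    {Z : C} (hZ : HasGradedLocalEnd K Z) : Simple (topFunctor.{w} hpos Z) where
  mono_isIso_iff_nonzero {T} f _ := by
    let R := repFunctor.{w} (K := K) (Opposite.op Z) 0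
    constructor
    · rintro hf rfl
      -- If zero were an isomorphism, the top would vanish, and 𝟙 Z, of degree zero, would lie in
      -- the positive part and be zero.
      have h0 : topπ.{w} hpos Z = 0 := by
        rw [← Category.comp_id (topπ hpos Z), ← IsIso.inv_hom_id (0 : T ⟶ topFunctor hpos Z),
          comp_zero, comp_zero]
      obtain ⟨y, hy⟩ := (topπ_exact hpos Z _ 0 (repGen (Opposite.op Z) 0)).1 (by rw [h0]; rfl)
      rw [positiveι_eq_zero hpos.op R (lt_irrefl 0)] at hy
      have h1 := congrArg (repEquiv (Opposite.op Z) 0 (Opposite.op Z) 0) hy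
      rw [_root_.map_zero, repGen, LinearEquiv.apply_symm_apply] at h1
      exact id_ne_zero_of_local hZ (congrArg (fun g ↦ g.1.unop) h1).symm
    · intro hf
      obtain ⟨X, i, t, ht⟩ : ∃ X i t, f.app X i t ≠ 0 := by
        by_contra! h
        exact hf (hom_ext h)
      obtain ⟨y, hy⟩ := surjective_of_epi (topπ.{w} hpos Z) X i (f.app X i t)
      have hi : ¬ 0 < i := fun hi ↦ ht (topFunctor_eq_zero hpos Z hi _)
      let h := repEquiv (Opposite.op Z) 0 X i y
      have hh : h.1 ≠ 0 := fun h0 ↦ ht (by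
        have : y = 0 := (repEquiv (Opposite.op Z) 0 X i).injective
          ((Subtype.ext h0).trans (_root_.map_zero _).symm)
        rw [← hy, this, _root_.map_zero])
      obtain rfl : i = 0 := by
        by_contra hne
        exact hh (homDeg_eq_zero hpos.op (by omega) h.2)
      obtain ⟨g, hg, hgh⟩ := exists_comp_eq_id hpos hrad hZ (f := h.1.unop)
        (homDeg_op (homDeg_congr (by omega) h.2))
        (fun h0 ↦ hh (Quiver.Hom.unop_inj h0))
      have hgen : R.map g.op 0 0 (homDeg_congr (by omega) (homDeg_op hg)) y =
          repGen (Opposite.op Z) 0 := by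
        apply (repEquiv (Opposite.op Z) 0 _ 0).injective
        rw [repEquiv_map, repGen, LinearEquiv.apply_symm_apply]
        exact Subtype.ext (Quiver.Hom.unop_inj hgh)
      have : Epi f := epi_of_surjective f fun Y j s ↦ by
        obtain ⟨s, rfl⟩ := surjective_of_epi (topπ.{w} hpos Z) Y j s
        refine ⟨T.map (repEquiv (Opposite.op Z) 0 Y j s).1 0 j
          (repEquiv (Opposite.op Z) 0 Y j s).2
          (T.map g.op 0 0 (homDeg_congr (by omega) (homDeg_op hg)) t), ?_⟩
        rw [f.naturality, f.naturality, ← hy, ← (topπ hpos Z).naturality, hgen,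
          ← (topπ hpos Z).naturality]
        congr 1
        exact rep_map_gen (Opposite.op Z) rfl s
      exact isIso_of_mono_of_epi f

/-- If `F` vanishes in degrees below `n` and its tensor product with the top of `Hom(Z, -)` is zero,
then `F(Z)_n` is zero. -/
lemma subsingleton_of_tensorIsZero (F : GrFunctor.{w} K C) (Z : C) (n : ℤ)
    (hF : ∀ (Y : C) (i : ℤ), i < n → Subsingleton (F.obj Y i))
    (h : TensorIsZero (topFunctor.{w} hpos Z) F) : Subsingleton (F.obj Z n) := by
  suffices h0 : ∀ x : F.obj Z (n - 0), x = 0 by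
    rw [sub_zero] at h0
    exact ⟨fun x y ↦ (h0 x).trans (h0 y).symm⟩
  intro x
  have := h n
  -- Under Hom(Z, -) ⊗ F ≅ F(Z), the element `x` is 𝟙 Z ⊗ x. Its image in the zero space S_Z ⊗ F
  -- vanishes, so it comes from the positive part.
  obtain ⟨w, hw⟩ := (tensorMap_exact_left F _ (topπ.{w} hpos Z) n (topπ_exact hpos Z)
    (tmul _ F n Z 0 (repGenOfEq (Opposite.op Z) rfl) x)).1 (Subsingleton.elim _ _)
  -- In total degree `n`, a morphism of degree i > 0 is paired with an element of degree n - i < n,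
  -- where `F` vanishes.
  have h1 : tensorRepRight F Z 0 n ∘ₗ
      tensorMap (positiveι hpos.op (repFunctor (Opposite.op Z) 0)) (𝟙 F) n = 0 := by
    refine tensor_hom_ext fun Y i t y ↦ ?_
    rw [LinearMap.comp_apply, tensorMap_tmul]
    by_cases hi : 0 < i
    · have := hF Y (n - i) (by omega)
      rw [Subsingleton.elim y 0, _root_.map_zero, _root_.map_zero, _root_.map_zero,
        LinearMap.zero_apply]
    · rw [positiveι_eq_zero hpos.op _ hi, _root_.map_zero, LinearMap.zero_apply, _root_.map_zero,
        LinearMap.zero_apply]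
  rw [← tensorRepRight_gen F Z 0 n x, ← hw]
  exact LinearMap.congr_fun h1 w

omit [LocallySmall.{w} C] in
lemma subsingleton_of_local [HasFiniteBiproducts C] (hKS : IsGradedKrullSchmidt K C)
    (F : GrFunctor.{w} K C) (n : ℤ)
    (h : ∀ Z, HasGradedLocalEnd K Z → Subsingleton (F.obj Z n)) (X : C) :
    Subsingleton (F.obj X n) := by
  obtain ⟨m, Z, q, p, hZ, hq, hp, hsum⟩ := exists_decomposition hpos hKS X
  have h0 : ∀ x : F.obj X n, x = 0 := fun x ↦ by
    rw [eq_sum_map_map F hq hp hsum n x]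
    refine Finset.sum_eq_zero fun a _ ↦ ?_
    have := h (Z a) (hZ a)
    rw [Subsingleton.elim (F.map (p a) n n _ x) 0, _root_.map_zero]
  exact ⟨fun x y ↦ (h0 x).trans (h0 y).symm⟩

/-- A bounded below functor is zero if its tensor products with the tops of the representable
functors of objects with graded local endomorphism rings are zero. -/
lemma isZero_of_tensorIsZero [HasFiniteBiproducts C] (hKS : IsGradedKrullSchmidt K C)
    (F : GrFunctor.{w} K C) (hF : F.IsBoundedBelow)
    (h : ∀ Z, HasGradedLocalEnd K Z → TensorIsZero (topFunctor.{w} hpos Z) F) : IsZero F := by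
  obtain ⟨N, hN⟩ := hF
  have key : ∀ (m : ℕ) (X : C) (i : ℤ), i < N + m → Subsingleton (F.obj X i) := by
    intro m
    induction m with
    | zero => simpa using hN
    | succ m ih =>
      intro X i hi
      exact subsingleton_of_local hpos hKS F i (fun Z hZ ↦
        subsingleton_of_tensorIsZero hpos F Z i (fun Y j hj ↦ ih Y j (by omega)) (h Z hZ)) X
  rw [IsZero.iff_id_eq_zero]
  ext X i x
  have := key (i - N + 1).toNat X i (by omega)
  exact Subsingleton.elim _ _

end Simple

/-- The radical of a graded functor over a positively graded category: the span of the images of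
the morphisms of positive degree. -/
def radSub (F : GrFunctor.{w} K C) (X : C) (j : ℤ) : Submodule K (F.obj X j) :=
  Submodule.span K {z | ∃ (Y : C) (i : ℤ) (f : X ⟶ Y) (hf : f ∈ homDeg K X Y (j - i))
    (y : F.obj Y i), i < j ∧ z = F.map f i j hf y}

lemma map_mem_radSub (F : GrFunctor.{w} K C) {X Y : C} {i j : ℤ} (hij : i < j) (f : X ⟶ Y)
    (hf : f ∈ homDeg K X Y (j - i)) (y : F.obj Y i) : F.map f i j hf y ∈ radSub F X j :=
  Submodule.subset_span ⟨Y, i, f, hf, y, hij, rfl⟩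

lemma map_radSub_le (F : GrFunctor.{w} K C) {X Y : C} {i : ℤ} (f : X ⟶ Y)
    (hf : f ∈ homDeg K X Y (i - i)) :
    radSub F Y i ≤ (radSub F X i).comap (F.map f i i hf) := by
  refine Submodule.span_le.2 ?_
  rintro _ ⟨Z, l, g, hg, z, hl, rfl⟩
  have h := LinearMap.congr_fun (F.map_comp f g l i i hf hg) z
  rw [SetLike.mem_coe, Submodule.mem_comap, ← LinearMap.comp_apply, ← h]
  exact map_mem_radSub F hl _ _ z

lemma app_radSub_le {F G : GrFunctor.{w} K C} (α : F ⟶ G) (X : C) (j : ℤ) :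
    radSub F X j ≤ (radSub G X j).comap (α.app X j) := by
  refine Submodule.span_le.2 ?_
  rintro _ ⟨Z, l, g, hg, z, hl, rfl⟩
  rw [SetLike.mem_coe, Submodule.mem_comap, α.naturality]
  exact map_mem_radSub G hl _ _ _

/-- A morphism with image in the radical is killed by the tensor product with the top of a
representable functor. -/
lemma tensorMap_top_eq_zero [LocallySmall.{w} C] (hpos : IsPositivelyGraded K C) (Z : C)
    {F F' : GrFunctor.{w} K C} (β : F ⟶ F') (hβ : ∀ i x, β.app Z i x ∈ radSub F' Z i) (n : ℤ) :
    tensorMap (𝟙 (topFunctor.{w} hpos Z)) β n = 0 := by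
  refine LinearMap.ext fun z ↦ ?_
  obtain ⟨z, rfl⟩ := tensorMap_surjective (topπ.{w} hpos Z) (𝟙 F) n z
  obtain ⟨x, rfl⟩ := exists_tmul_repGen F Z 0 n z
  rw [tensorMap_tmul, tensorMap_tmul, id_app, id_app, LinearMap.zero_apply]
  generalize (topπ.{w} hpos Z).app _ 0 _ = s
  have h : radSub F' Z (n - 0) ≤ LinearMap.ker (tmul (topFunctor.{w} hpos Z) F' n Z 0 s) := by
    refine Submodule.span_le.2 ?_
    rintro _ ⟨Y, i, f, hf, y, hi, rfl⟩
    -- In this form `f` has degree j > 0 and can be moved across the tensor sign; it then acts on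
    -- `s`, landing in a positive degree of the top, which is zero.
    obtain ⟨j, rfl⟩ : ∃ j, i = n - j := ⟨n - i, by omega⟩
    have h0 := topFunctor_eq_zero hpos Z (by omega)
      ((topFunctor.{w} hpos Z).map f.op 0 j (homDeg_op (homDeg_congr (by omega) hf)) s)
    rw [SetLike.mem_coe, LinearMap.mem_ker, ← tmul_map f 0 j (homDeg_congr (by omega) hf), h0,
      _root_.map_zero, LinearMap.zero_apply]
  exact h (hβ _ x)

end GrFunctor

/-! ### Projective covers of bounded below functors -/

section

variable (K : Type k) [Field K] (C : Type u) [Category.{v} C] [Preadditive C] [Linear K C]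
  [GradedCategory K C] [EssentiallySmall.{w} C]

/-- The index type has to lie in `Type w` for direct sums to exist. Each representative is chosen to
be local itself, so no invariance of locality under isomorphism is needed. -/
lemma exists_local_representatives :
    ∃ (J : Type w) (Z : J → C), (∀ s, HasGradedLocalEnd K (Z s)) ∧
      ∀ Y, HasGradedLocalEnd K Y → ∃ s, Nonempty (Y ≅ Z s) := by
  let J := {s : SmallModel.{w} C // ∃ Z : C, HasGradedLocalEnd K Z ∧
    Nonempty (Z ≅ (equivSmallModel.{w} C).inverse.obj s)}
  refine ⟨J, fun s ↦ s.2.choose, fun s ↦ s.2.choose_spec.1, fun Y hY ↦ ?_⟩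
  let e := (equivSmallModel.{w} C).unitIso.app Y
  let s : J := ⟨(equivSmallModel.{w} C).functor.obj Y, Y, hY, ⟨e⟩⟩
  obtain ⟨e'⟩ := s.2.choose_spec.2
  exact ⟨s, ⟨e ≪≫ e'.symm⟩⟩

end

namespace GrFunctor

variable {K : Type k} [Field K] {C : Type u} [Category.{v} C] [Preadditive C] [Linear K C]
  [GradedCategory K C]

/-- Homogeneous elements of `F(Z s)`, of degree at least `N`. -/
structure Gen {J : Type w} (Z : J → C) (F : GrFunctor.{w} K C) (N : ℤ) : Type w where
  idx : J
  deg : ℤ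
  le_deg : N ≤ deg
  elem : F.obj (Z idx) deg

/-! ### Elements independent modulo the radical and the cover they define -/

section Cover

variable {J : Type w} {Z : J → C} {F : GrFunctor.{w} K C} {N : ℤ}

/-- A set of homogeneous elements is independent modulo the radical of `F` if there are no
nontrivial relations between them with coefficients of degree zero. -/
def IndependentModRad (B : Set (Gen Z F N)) : Prop :=
  ∀ Y : C, HasGradedLocalEnd K Y → ∀ (d : ℤ) (t : Finset (Gen Z F N))
    (h : ∀ b : Gen Z F N, homDeg K Y (Z b.idx) (d - b.deg)), (t : Set (Gen Z F N)) ⊆ B →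
    (∀ b ∈ t, b.deg = d) → ∑ b ∈ t, actLin F Y d b.elem (h b) ∈ radSub F Y d →
    ∀ b ∈ t, h b = 0

variable (Z F N) in
-- Independence concerns finitely many elements at a time, so it is a property of finite character
-- and Tukey's lemma applies.
lemma exists_maximal_independentModRad :
    ∃ B : Set (Gen Z F N), Maximal IndependentModRad B := by
  have hfin : Order.IsOfFiniteCharacter {B : Set (Gen Z F N) | IndependentModRad B} := by
    intro B
    refine ⟨fun hB B' hB' _ Y hY d t h ht ↦ hB Y hY d t h (ht.trans hB'),
      fun hB Y hY d t h ht ↦ hB t ht t.finite_toSet Y hY d t h le_rfl⟩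
  obtain ⟨B, -, hB⟩ := hfin.exists_maximal (x := ∅) (fun Y hY d t h ht _ _ b hb ↦ (ht hb).elim)
  exact ⟨B, hB⟩

variable [LocallySmall.{w} C] (B : Set (Gen Z F N))

/-- The sum of the representable functors given by a set of homogeneous elements. -/
noncomputable def coverFunctor : GrFunctor.{w} K C :=
  sumFunctor fun b : B ↦ repFunctor.{w} (K := K) (Z b.1.idx) b.1.deg

instance : Projective (coverFunctor B) := projective_sum _

/-- The morphism to `F` given by a set of homogeneous elements. -/
noncomputable def coverπ : coverFunctor B ⟶ F :=
  sumDesc fun b : B ↦ repHom F (Z b.1.idx) b.1.deg b.1.elem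

lemma coverπ_ι (b : B) (Y : C) (d : ℤ)
    (y : (repFunctor.{w} (K := K) (Z b.1.idx) b.1.deg).obj Y d) :
    (coverπ B).app Y d ((sumι _ b).app Y d y) =
      actLin F Y d b.1.elem (repEquiv (Z b.1.idx) b.1.deg Y d y) :=
  congrArg (fun δ : repFunctor (Z b.1.idx) b.1.deg ⟶ F ↦ δ.app Y d y)
    (sumι_desc (fun b : B ↦ repHom F (Z b.1.idx) b.1.deg b.1.elem) b)

lemma actLin_mem_range {b : Gen Z F N} (hb : b ∈ B) (Y : C) (d : ℤ)
    (h : homDeg K Y (Z b.idx) (d - b.deg)) :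
    actLin F Y d b.elem h ∈ LinearMap.range ((coverπ B).app Y d) :=
  ⟨(sumι (fun b : B ↦ repFunctor (Z b.1.idx) b.1.deg) ⟨b, hb⟩).app Y d
    ((repEquiv (Z b.idx) b.deg Y d).symm h), by
    rw [coverπ_ι, LinearEquiv.apply_symm_apply]⟩

omit [LocallySmall.{w} C] in
lemma map_range_le {P F : GrFunctor.{w} K C} (π : P ⟶ F) {X Y : C} {i j : ℤ} (f : X ⟶ Y)
    (hf : f ∈ homDeg K X Y (j - i)) :
    LinearMap.range (π.app Y i) ≤ (LinearMap.range (π.app X j)).comap (F.map f i j hf) := by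
  rintro _ ⟨y, rfl⟩
  exact ⟨P.map f i j hf y, π.naturality f i j hf y⟩

variable (hpos : IsPositivelyGraded K C)
include hpos

lemma coverFunctor_isBoundedBelow : (coverFunctor B).IsBoundedBelow := by
  refine ⟨N, fun X i hi ↦ ?_⟩
  have h0 : ∀ x : ⨁ b : B, (repFunctor.{w} (K := K) (Z b.1.idx) b.1.deg).obj X i, x = 0 :=
    fun x ↦ DFinsupp.ext fun b ↦ (repEquiv (Z b.1.idx) b.1.deg X i).injective <| by
      have hb := b.1.le_deg
      rw [DFinsupp.zero_apply, _root_.map_zero]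
      exact Subtype.ext (homDeg_eq_zero hpos (by omega) (Subtype.property _))
  exact ⟨fun x y ↦ (h0 x).trans (h0 y).symm⟩

variable (hrad : ∀ X Y : C, gradedRadical K X Y = (positivePart K X Y : Set (X ⟶ Y)))
include hrad

/-- As with bases of vector spaces: an element outside the image plus the radical could be added to
`B`, since a nonzero coefficient of degree zero between local objects is invertible and a relation
could be solved for the new element. -/
lemma mem_range_sup_radSub (hZ : ∀ s, HasGradedLocalEnd K (Z s))
    (hrep : ∀ Y, HasGradedLocalEnd K Y → ∃ s, Nonempty (Y ≅ Z s))
    (hF : ∀ (X : C) (i : ℤ), i < N → Subsingleton (F.obj X i))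
    (hB : Maximal IndependentModRad B) {Y : C} (hY : HasGradedLocalEnd K Y) (d : ℤ)
    (x : F.obj Y d) : x ∈ LinearMap.range ((coverπ B).app Y d) ⊔ radSub F Y d := by
  classical
  have hN : N ≤ d ∨ x = 0 := by
    by_cases hd : N ≤ d
    · exact Or.inl hd
    · have := hF Y d (by omega)
      exact Or.inr (Subsingleton.elim _ _)
  rcases hN with hN | rfl
  swap
  · exact zero_mem _
  have hle : ∀ {X Y : C} (f : X ⟶ Y) (hf : f ∈ homDeg K X Y (d - d)),
      LinearMap.range ((coverπ B).app Y d) ⊔ radSub F Y d ≤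
        (LinearMap.range ((coverπ B).app X d) ⊔ radSub F X d).comap (F.map f d d hf) :=
    fun f hf ↦ sup_le ((map_range_le _ f hf).trans (Submodule.comap_mono le_sup_left))
      ((map_radSub_le F f hf).trans (Submodule.comap_mono le_sup_right))
  obtain ⟨s, ⟨e⟩⟩ := hrep Y hY
  -- Only the elements at the representatives `Z s` are candidates for `B`, so `x` is transported
  -- there; degree zero keeps it in degree `d`.
  let e₀ := isoZeroPart hpos e
  have hhom : e₀.hom ∈ homDeg K Y (Z s) (d - d) := homDeg_congr (by omega) (zeroPart_mem K e.hom)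
  have hinv : e₀.inv ∈ homDeg K (Z s) Y (d - d) := homDeg_congr (by omega) (zeroPart_mem K e.inv)
  let x' := F.map e₀.inv d d hinv x
  suffices hx' : x' ∈ LinearMap.range ((coverπ B).app (Z s) d) ⊔ radSub F (Z s) d by
    have h1 : F.map e₀.hom d d hhom x' = x := by
      have h2 := LinearMap.congr_fun (F.map_comp e₀.hom e₀.inv d d d hhom hinv) x
      rw [F.map_congr e₀.hom_inv_id _ (homDeg_id Y d), F.map_id] at h2
      exact h2.symm
    rw [← h1]
    exact hle e₀.hom hhom hx'
  by_contra hx'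
  let b₀ : Gen Z F N := ⟨s, d, hN, x'⟩
  have hind : IndependentModRad (insert b₀ B) := by
    intro Y' hY' d' t h ht hdeg hsum
    have hsub : ((t.erase b₀ : Finset _) : Set (Gen Z F N)) ⊆ B := fun b hb ↦ by
      rw [Finset.mem_coe, Finset.mem_erase] at hb
      exact (ht hb.2).resolve_left hb.1
    -- Either the new element does not really occur, and the relation is one within `B`, or its
    -- coefficient is invertible and puts `x'` into the image plus the radical, contrary to
    -- assumption.
    by_cases hb₀ : b₀ ∈ t → h b₀ = 0
    · have hsum' : ∑ b ∈ t.erase b₀, actLin F Y' d' b.elem (h b) ∈ radSub F Y' d' := by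
        by_cases hbt : b₀ ∈ t
        · rwa [Finset.sum_erase _ (by rw [hb₀ hbt, _root_.map_zero])]
        · rwa [Finset.erase_eq_of_notMem hbt]
      intro b hb
      by_cases hbb : b = b₀
      · subst hbb
        exact hb₀ hb
      · exact hB.prop Y' hY' d' _ h hsub (fun b hb ↦ hdeg b (Finset.mem_of_mem_erase hb)) hsum' b
          (Finset.mem_erase.2 ⟨hbb, hb⟩)
    · exfalso
      obtain ⟨hbt, hne⟩ := Classical.not_imp.1 hb₀
      obtain rfl : d = d' := hdeg b₀ hbt
      have hf : (h b₀).1 ∈ homDeg K Y' (Z s) (d - d) := (h b₀).2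
      obtain ⟨g, hg, -, hgf⟩ := exists_inverse hpos hrad hY' (hZ s) (homDeg_congr (by omega) hf)
        (fun h0 ↦ hne (Subtype.ext h0))
      have hg' : g ∈ homDeg K (Z s) Y' (d - d) := homDeg_congr (by omega) hg
      have h1 : F.map g d d hg' (actLin F Y' d b₀.elem (h b₀)) = x' := by
        have h2 := LinearMap.congr_fun (F.map_comp g (h b₀).1 d d d hg' hf) x'
        rw [F.map_congr hgf _ (homDeg_id (Z s) d), F.map_id] at h2
        exact h2.symm
      have h3 : actLin F Y' d b₀.elem (h b₀) =
          ∑ b ∈ t, actLin F Y' d b.elem (h b) - ∑ b ∈ t.erase b₀, actLin F Y' d b.elem (h b) := by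
        rw [← Finset.add_sum_erase t _ hbt, add_sub_cancel_right]
      apply hx'
      rw [← h1]
      refine hle g hg' ?_
      rw [h3]
      refine sub_mem (Submodule.mem_sup_right hsum) (Submodule.mem_sup_left ?_)
      exact Submodule.sum_mem _ fun b hb ↦ actLin_mem_range B (hsub hb) Y' d (h b)
  have hmem : b₀ ∈ B := hB.le_of_ge hind (Set.subset_insert _ _) (Set.mem_insert _ _)
  apply hx'
  refine Submodule.mem_sup_left ?_
  have h1 := actLin_mem_range B hmem (Z s) d ⟨𝟙 (Z s), homDeg_id (Z s) d⟩
  rw [actLin_apply, F.map_id] at h1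
  exact h1

/-- Nakayama by induction on the degree: the radical in degree `i` comes from elements of lower
degree, which are already in the image, so at local objects image plus radical is just the image. -/
lemma epi_coverπ [HasFiniteBiproducts C] (hKS : IsGradedKrullSchmidt K C)
    (hZ : ∀ s, HasGradedLocalEnd K (Z s))
    (hrep : ∀ Y, HasGradedLocalEnd K Y → ∃ s, Nonempty (Y ≅ Z s))
    (hF : ∀ (X : C) (i : ℤ), i < N → Subsingleton (F.obj X i))
    (hB : Maximal IndependentModRad B) : Epi (coverπ B) := by
  have key : ∀ (m : ℕ) (X : C) (i : ℤ), i < N + m →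
      ∀ x, x ∈ LinearMap.range ((coverπ B).app X i) := by
    intro m
    induction m with
    | zero =>
      intro X i hi x
      have := hF X i (by simpa using hi)
      rw [Subsingleton.elim x 0]
      exact zero_mem _
    | succ m ih =>
      intro X i hi x
      have hle : ∀ Y, radSub F Y i ≤ LinearMap.range ((coverπ B).app Y i) := by
        intro Y
        refine Submodule.span_le.2 ?_
        rintro _ ⟨Y', j, f, hf, y, hj, rfl⟩
        exact map_range_le _ f hf (ih Y' j (by omega) y)
      obtain ⟨n, Y, q, p, hY, hq, hp, hsum⟩ := exists_decomposition hpos hKS X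
      rw [eq_sum_map_map F hq hp hsum i x]
      refine Submodule.sum_mem _ fun a _ ↦ map_range_le _ _ _ ?_
      exact (sup_le le_rfl (hle (Y a)))
        (mem_range_sup_radSub B hpos hrad hZ hrep hF hB (hY a) i _)
  exact epi_of_surjective _ fun X i x ↦ key (i - N + 1).toNat X i (by omega) x

omit hrad in
-- The components of `x` at generators of degree above `d` vanish, and those at generators of degree
-- below `d` lie in the radical. The remaining ones have coefficients of degree zero; since `x` maps
-- to zero, these give a relation modulo the radical of `F`, so they vanish by independence.
lemma mem_radSub_of_coverπ_eq_zero (hB : IndependentModRad B) {Y : C}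
    (hY : HasGradedLocalEnd K Y) (d : ℤ) (x : (coverFunctor B).obj Y d)
    (hx : (coverπ B).app Y d x = 0) : x ∈ radSub (coverFunctor B) Y d := by
  classical
  let R : B → GrFunctor.{w} K C := fun b ↦ repFunctor.{w} (K := K) (Z b.1.idx) b.1.deg
  let c : ∀ b : B, (R b).obj Y d := fun b ↦ (sumπ R b).app Y d x
  obtain ⟨s, hs⟩ := exists_sum_component R Y d x
  let y : B → (coverFunctor B).obj Y d := fun b ↦ (sumι R b).app Y d (c b)
  have hsum : ∑ b ∈ s, y b = x := hs s le_rfl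
  have hne : ∀ b : B, b.1.deg ≠ d →
      y b ∈ radSub (coverFunctor B) Y d := by
    intro b hb
    rcases lt_or_gt_of_ne hb with hlt | hgt
    · refine app_radSub_le (sumι R b) Y d ?_
      rw [← rep_map_gen (Z b.1.idx) rfl (c b)]
      exact map_mem_radSub _ hlt _ _ _
    · have h0 : c b = 0 := (repEquiv (Z b.1.idx) b.1.deg Y d).injective <| by
        rw [_root_.map_zero]
        exact Subtype.ext (homDeg_eq_zero hpos (by omega) (Subtype.property _))
      have h1 : y b = 0 := by
        change (sumι R b).app Y d (c b) = 0
        rw [h0, _root_.map_zero]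
      rw [h1]
      exact zero_mem _
  -- `IndependentModRad` takes coefficients on all of `Gen`; the value 0 outside `B` is arbitrary.
  let h : ∀ b : Gen Z F N, homDeg K Y (Z b.idx) (d - b.deg) := fun b ↦
    if hb : b ∈ B then repEquiv (Z b.idx) b.deg Y d (c ⟨b, hb⟩) else 0
  have hh : ∀ b : B, h b.1 = repEquiv (Z b.1.idx) b.1.deg Y d (c b) := fun b ↦ dif_pos b.2
  let t : Finset (Gen Z F N) :=
    (s.filter fun b ↦ b.1.deg = d).map (Function.Embedding.subtype _)
  have hsplit := Finset.sum_filter_add_sum_filter_not s (fun b : B ↦ b.1.deg = d)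
    y
  have hrest : ∑ b ∈ s.filter (fun b ↦ ¬ b.1.deg = d), y b ∈
      radSub (coverFunctor B) Y d :=
    Submodule.sum_mem _ fun b hb ↦ hne b (Finset.mem_filter.1 hb).2
  have ht : ∑ b ∈ t, actLin F Y d b.elem (h b) ∈ radSub F Y d := by
    have h1 : ∑ b ∈ t, actLin F Y d b.elem (h b) =
        (coverπ B).app Y d (∑ b ∈ s.filter (fun b ↦ b.1.deg = d), y b) := by
      rw [_root_.map_sum, Finset.sum_map]
      refine Finset.sum_congr rfl fun b _ ↦ ?_
      rw [Function.Embedding.subtype_apply, hh b]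
      exact (coverπ_ι B b Y d (c b)).symm
    rw [h1, eq_sub_of_add_eq hsplit, hsum]
    rw [_root_.map_sub, hx, zero_sub]
    exact neg_mem (app_radSub_le (coverπ B) Y d hrest)
  have hzero := hB Y hY d t h (fun b hb ↦ by
      obtain ⟨b, -, rfl⟩ := Finset.mem_map.1 hb
      exact b.2) (fun b hb ↦ by
      obtain ⟨b, hb', rfl⟩ := Finset.mem_map.1 hb
      exact (Finset.mem_filter.1 hb').2) ht
  have hfirst : ∑ b ∈ s.filter (fun b ↦ b.1.deg = d), y b = 0 := by
    refine Finset.sum_eq_zero fun b hb ↦ ?_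
    have h1 := hzero b.1 (Finset.mem_map_of_mem (Function.Embedding.subtype _) hb)
    rw [hh b] at h1
    change (sumι R b).app Y d (c b) = 0
    rw [(repEquiv (Z b.1.idx) b.1.deg Y d).injective (h1.trans (_root_.map_zero _).symm),
      _root_.map_zero]
  rw [← hsum, ← hsplit, hfirst, zero_add]
  exact hrest

end Cover

/-- Every bounded below functor has a projective cover that is bounded below. -/
lemma exists_projective_cover [EssentiallySmall.{w} C] [HasFiniteBiproducts C]
    (hpos : IsPositivelyGraded K C) (hKS : IsGradedKrullSchmidt K C)
    (hrad : ∀ X Y : C, gradedRadical K X Y = (positivePart K X Y : Set (X ⟶ Y)))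
    (F : GrFunctor.{w} K C) (hF : F.IsBoundedBelow) :
    ∃ (P : GrFunctor.{w} K C) (π : P ⟶ F), Projective P ∧ Epi π ∧ P.IsBoundedBelow ∧
      ∀ Y, HasGradedLocalEnd K Y → ∀ (i : ℤ) (x : P.obj Y i), π.app Y i x = 0 →
        x ∈ radSub P Y i := by
  obtain ⟨N, hN⟩ := hF
  obtain ⟨J, Z, hZ, hrep⟩ := exists_local_representatives.{w} K C
  obtain ⟨B, hB⟩ := exists_maximal_independentModRad Z F N
  exact ⟨coverFunctor B, coverπ B, inferInstance, epi_coverπ B hpos hrad hKS hZ hrep hN hB,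
    coverFunctor_isBoundedBelow B hpos,
    fun Y hY i x hx ↦ mem_radSub_of_coverπ_eq_zero B hpos hB.prop hY i x hx⟩

end GrFunctor

/-! ### The main theorem -/

namespace GrFunctor

variable {K : Type k} [Field K] {C : Type u} [Category.{v} C] [Preadditive C] [Linear K C]
  [GradedCategory K C]

/-- If `G ⊗ -` kills the kernel inclusion of one projective presentation of `F` and is injective on
that of another one, then it kills the kernel of the first one. -/
lemma tensorIsZero_kernel (G : GrFunctor.{w} K Cᵒᵖ) {P Q F : GrFunctor.{w} K C} [Projective P]
    [Projective Q] (π : P ⟶ F) (ρ : Q ⟶ F) [Epi π] [Epi ρ]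
    (hπ : ∀ n, tensorMap (𝟙 G) (kernelι π) n = 0)
    (hρ : ∀ n, Function.Injective (tensorMap (𝟙 G) (kernelι ρ) n)) :
    TensorIsZero G (kernelFunctor π) := by
  intro n
  let f : P ⟶ Q := Projective.factorThru π ρ
  let g : Q ⟶ P := Projective.factorThru ρ π
  have hf : f ≫ ρ = π := Projective.factorThru_comp _ _
  have hg : g ≫ π = ρ := Projective.factorThru_comp _ _
  let f' : kernelFunctor π ⟶ kernelFunctor ρ :=
    kernelLift ρ (kernelι π ≫ f) (by rw [Category.assoc, hf, kernelι_comp])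
  let g' : kernelFunctor ρ ⟶ kernelFunctor π :=
    kernelLift π (kernelι ρ ≫ g) (by rw [Category.assoc, hg, kernelι_comp])
  -- As in Schanuel's lemma, `f ≫ g` and the identity of `P` agree over `F`; their difference
  -- factors through the kernel and exhibits `f' ≫ g'` as homotopic to the identity.
  let s : P ⟶ kernelFunctor π :=
    kernelLift π (𝟙 P - f ≫ g) (by simp [Preadditive.sub_comp, hf, hg])
  have hf' : f' ≫ kernelι ρ = kernelι π ≫ f := rfl
  have hg' : g' ≫ kernelι π = kernelι ρ ≫ g := rfl
  have hs : s ≫ kernelι π = 𝟙 P - f ≫ g := rfl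
  have hid : 𝟙 (kernelFunctor π) = kernelι π ≫ s + f' ≫ g' := by
    rw [← cancel_mono (kernelι π), Preadditive.add_comp, Category.assoc, Category.assoc, hs, hg',
      ← Category.assoc f', hf', Preadditive.comp_sub]
    simp
  have hT : ∀ {A B D : GrFunctor.{w} K C} (a : A ⟶ B) (b : B ⟶ D),
      tensorMap (𝟙 G) (a ≫ b) n = tensorMap (𝟙 G) b n ∘ₗ tensorMap (𝟙 G) a n := fun a b ↦ by
    rw [← tensorMap_comp, Category.id_comp]
  -- Followed by the injective map of `hρ`, G ⊗ f' factors through G ⊗ ker π → G ⊗ P, which is zero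
  -- by `hπ`. Hence both summands of the identity vanish after tensoring.
  have hf0 : tensorMap (𝟙 G) f' n = 0 := by
    refine LinearMap.ext fun z ↦ hρ n ?_
    rw [← LinearMap.comp_apply, ← hT, hf', hT, hπ]
    simp
  have h1 := tensorMap_id G (kernelFunctor π) n
  rw [hid, tensorMap_add, hT, hT, hπ, hf0, LinearMap.comp_zero, LinearMap.comp_zero,
    add_zero] at h1
  exact ⟨fun x y ↦ (LinearMap.congr_fun h1.symm x).trans (LinearMap.congr_fun h1 y)⟩

lemma IsBoundedBelow.kernelFunctor {P F : GrFunctor.{w} K C} (hP : P.IsBoundedBelow) (π : P ⟶ F) :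
    (kernelFunctor π).IsBoundedBelow := by
  obtain ⟨N, hN⟩ := hP
  refine ⟨N, fun X i hi ↦ ?_⟩
  have := hN X i hi
  exact ⟨fun x y ↦ Subtype.ext (Subsingleton.elim _ _)⟩

variable [HasFiniteBiproducts C] [EssentiallySmall.{w} C]
  (hpos : IsPositivelyGraded K C) (hKS : IsGradedKrullSchmidt K C)
  (hrad : ∀ X Y : C, gradedRadical K X Y = (positivePart K X Y : Set (X ⟶ Y)))
include hpos hKS hrad

/-- A bounded below functor is projective if the kernel of some projective presentation is
preserved by the tensor product with every simple functor. -/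
lemma projective_of_tensorMap_kernelι_injective {F Q : GrFunctor.{w} K C} (hF : F.IsBoundedBelow)
    [Projective Q] (ρ : Q ⟶ F) [Epi ρ]
    (h : ∀ S : GrFunctor.{w} K Cᵒᵖ, Simple S → ∀ n,
      Function.Injective (tensorMap (𝟙 S) (kernelι ρ) n)) : Projective F := by
  obtain ⟨P, π, _, _, hP, hker⟩ := exists_projective_cover hpos hKS hrad F hF
  have hzero : IsZero (kernelFunctor π) :=
    isZero_of_tensorIsZero hpos hKS _ (hP.kernelFunctor π) fun Z hZ ↦
      tensorIsZero_kernel _ π ρ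
        (tensorMap_top_eq_zero hpos Z _ fun i x ↦
          hker Z hZ i _ ((kernelι_exact π Z i _).2 ⟨x, rfl⟩))
        (h _ (simple_topFunctor hpos hrad hZ))
  have : Mono π := Preadditive.mono_of_isZero_kernel' _ (kernelIsLimit π) hzero
  have : IsIso π := isIso_of_mono_of_epi π
  exact Projective.of_iso (asIso π) inferInstance

/-- Passing to the kernel of a cover lowers `m` by one. Bounded below covers keep the syzygies
bounded below, so that the projectivity criterion applies to the last one. -/
lemma hasProjectiveDimensionLE_of_syzygyInjective (m : ℕ) (F : GrFunctor.{w} K C)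
    (hF : F.IsBoundedBelow)
    (h : ∀ S : GrFunctor.{w} K Cᵒᵖ, Simple S → SyzygyInjective m S F) :
    HasProjectiveDimensionLE F m := by
  obtain ⟨P, π, _, _, hP, -⟩ := exists_projective_cover hpos hKS hrad F hF
  induction m generalizing F P with
  | zero =>
    rw [← projective_iff_hasProjectiveDimensionLE_zero]
    exact projective_of_tensorMap_kernelι_injective hpos hKS hrad hF π fun S hS ↦ h S hS P π
  | succ m ih =>
    have hker := hP.kernelFunctor π
    obtain ⟨P', π', hP'₁, hP'₂, hP', -⟩ := exists_projective_cover hpos hKS hrad _ hker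
    have h1 : HasProjectiveDimensionLE (GrFunctor.kernelFunctor π) m :=
      ih _ hker (fun S hS ↦ h S hS P π) P' π' hP'₁ hP'₂ hP'
    exact ((kernel_shortExact π).hasProjectiveDimensionLT_X₃_iff m ‹_›).2 h1

end GrFunctor

theorem mainTheorem11 {K : Type k} [Field K] {C : Type u} [Category.{v} C] [Preadditive C]
    [Linear K C] [HasFiniteBiproducts C] [EssentiallySmall.{w} C] [GradedCategory K C]
    (hpos : IsPositivelyGraded K C) (hKS : IsGradedKrullSchmidt K C)
    (hrad : ∀ X Y : C, gradedRadical K X Y = (positivePart K X Y : Set (X ⟶ Y)))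
    (F : GrFunctor.{w} K C) (hF : F.IsBoundedBelow) :
    ((∀ S : GrFunctor.{w} K Cᵒᵖ, Simple S → GrFunctor.TensorIsZero S F) → IsZero F) ∧
    ((∀ S : GrFunctor.{w} K Cᵒᵖ, Simple S → GrFunctor.TorIsZero 1 S F) → Projective F) ∧
    (F.IsFlat → Projective F) ∧
    (∀ n : ℕ, (∀ S : GrFunctor.{w} K Cᵒᵖ, Simple S → HasProjectiveDimensionLE S n) →
      HasProjectiveDimensionLE F n) := by
  refine ⟨fun h ↦ ?_, fun h ↦ ?_, fun h ↦ ?_, fun n h ↦ ?_⟩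
  · exact GrFunctor.isZero_of_tensorIsZero hpos hKS F hF fun Z hZ ↦
      h _ (GrFunctor.simple_topFunctor hpos hrad hZ)
  -- The resolution computing Tor need be neither minimal nor bounded below; the criterion compares
  -- its first step with the projective cover.
  · let R := projectiveResolution F
    let ρ : R.complex.X 0 ⟶ F := R.π.f 0
    have : Epi ρ := epi_of_isColimit_cofork R.isColimitCokernelCofork
    exact GrFunctor.projective_of_tensorMap_kernelι_injective hpos hKS hrad hF ρ
      fun S hS ↦ (h S hS).injective R
  · rw [projective_iff_hasProjectiveDimensionLE_zero]
    exact GrFunctor.hasProjectiveDimensionLE_of_syzygyInjective hpos hKS hrad 0 F hF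
      fun S _ ↦ h.syzygyInjective S
  · refine GrFunctor.hasProjectiveDimensionLE_of_syzygyInjective hpos hKS hrad n F hF
      fun S hS ↦ ?_
    have := h S hS
    exact GrFunctor.syzygyInjective_of_hasProjectiveDimensionLE n S F
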